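/- The balance game on a finite simple graph $G$ is played by two players, Admirable and Impish, who alternately select a not yet labelled vertex of $G$ until all vertices are labelled; Admirable labels the vertices he selects by $0$ and Impish by $1$. The label of an edge is the sum modulo $2$ of the labels of its two ends; let $e_0$ and $e_1$ be the final numbers of edges labelled $0$ and $1$. Admirable tries to minimize the discrepancy $e_1-e_0$, Impish tries to maximize it. Let $b^I_g(G)$ be the value of $e_1-e_0$ when both players play optimally and Impish makes the first move. Then for every integer $n\ge 1$ the path $P_n$ on $n$ vertices satisfies $$2\left\lfloor \frac{n}{16}\right\rfloor - 5 \;\le\; b^I_g(P_n) \;\le\; 4\left\lceil \frac{n}{16}\right\rceil - 1 \quad\text{if } n \text{ is even},$$ $$2\left\lfloor \frac{n}{16}\right\rfloor \;\le\; b^I_g(P_n) \;\le\; 4\left\lceil \frac{n}{16}\right\rceil + 4 \quad\text{if } n \text{ is odd}.$$ -/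

import Mathlib

namespace BalanceGame

/-- The two players: Admirable labels vertices by `0`, Impish labels vertices by `1`. -/
inductive Player
  | admirable
  | impish

section

variable {V : Type*} [Fintype V] [DecidableEq V] (G : SimpleGraph V) [DecidableRel G.Adj]

/-- The edges labelled `1` in the state `(S₀, S₁)`: one end is labelled `0`, the other `1`. -/
def edgesOne (S₀ S₁ : Finset V) : Finset (Sym2 V) :=
  G.edgeFinset.filter fun e => (∃ x ∈ e, x ∈ S₀) ∧ ∃ y ∈ e, y ∈ S₁

/-- The edges labelled `0` in the state `(S₀, S₁)`: both ends carry the same label. -/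
def edgesZero (S₀ S₁ : Finset V) : Finset (Sym2 V) :=
  G.edgeFinset.filter fun e => (∀ x ∈ e, x ∈ S₀) ∨ ∀ x ∈ e, x ∈ S₁

/-- The discrepancy `e₁ - e₀` of the state `(S₀, S₁)`, where `S₀` and `S₁` are the (disjoint) sets
of vertices labelled so far by Admirable and by Impish. -/
def score (S₀ S₁ : Finset V) : ℤ :=
  ((edgesOne G S₀ S₁).card : ℤ) - ((edgesZero G S₀ S₁).card : ℤ)

/-- The value of the balance game on `G` under optimal play, from the state `(S₀, S₁)` with the
given player to move. If all vertices are labelled, it is the discrepancy. Otherwise the player to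
move labels an unlabelled vertex and the turn passes; Admirable minimizes, Impish maximizes. -/
def value (p : Player) (S₀ S₁ : Finset V) : ℤ :=
  if h : (S₀ ∪ S₁)ᶜ.Nonempty then
    match p with
    | .admirable =>
        (S₀ ∪ S₁)ᶜ.attach.inf' (Finset.attach_nonempty_iff.mpr h) fun v =>
          value .impish (insert v.1 S₀) S₁
    | .impish =>
        (S₀ ∪ S₁)ᶜ.attach.sup' (Finset.attach_nonempty_iff.mpr h) fun v =>
          value .admirable S₀ (insert v.1 S₁)
  else score G S₀ S₁
termination_by (S₀ ∪ S₁)ᶜ.card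
decreasing_by
  all_goals
    obtain ⟨v, hv⟩ := v
    refine Finset.card_lt_card (Finset.ssubset_iff_of_subset ?_ |>.mpr ⟨v, hv, ?_⟩)
    · intro x hx
      simp only [Finset.mem_compl, Finset.mem_union, Finset.mem_insert] at hx ⊢
      tauto
    · simp

/-- The game balance number `b_g^I(G)`: Impish makes the first move. -/
def balanceNumberI : ℤ := value G .impish ∅ ∅

end

end BalanceGame

namespace BalanceGame

/-! A path on `n` vertices has `e₀ + e₁ = n - 1`, so an upper bound on the discrepancy says that
Admirable can force many edges with equal ends, and a lower bound that Impish can force many edges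
with different ends. Both are treated as tasks of the second player in a game on a list (`Forces`).
Strategies on consecutive blocks combine by answering in the block where the opponent has just moved
(`Forces.append`); the edges between blocks are given away.

The blocks have 16 vertices. Admirable forces 6 equal edges in a block (`forces_equal_sixteen`), so
a block with one adjoining edge contributes at most `16 - 2 * 6 = 4`. Impish forces 9 different
edges (`forces_different_sixteen`), so it contributes at least `2 * 9 - 16 = 2`. These are the
coefficients of the two bounds; a shorter last block changes only the constants.

The block strategies are finite trees checked by computation. Each branch ends in a pairing
strategy, which makes the two labels of every pair different, so that it is enough to enumerate the
labellings respecting the pairs. For different edges the block is closed to a cycle, whose rotations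
reduce all opening moves to one.

The order of moves is handled by `value_admirable_le_value_impish`: when the number of unlabelled
vertices is even, having the move is no disadvantage. Hence for even `n` Impish, who starts, does at
least as well as a second player. For odd `n` Impish may open at the last vertex and be second on
the rest, while Admirable plays second on all vertices but the last and loses nothing when Impish
takes that one. -/

/-- The number of pairs of consecutive entries of a list that are equal (`s = true`) or different
(`s = false`). -/
def cnt (s : Bool) : List Bool → ℕ
  | a :: b :: l => (if (a == b) = s then 1 else 0) + cnt s (b :: l)
  | _ => 0

/-! ### Forcing strategies of a second player on a list. -/

/-- The second player of a labelling game on a list can force a final labelling in `P`. The first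
player labels entries by `false`, the second player by `true`, and the first player is to move. -/
inductive Forces (P : List Bool → Prop) : List (Option Bool) → Prop
  | intro (L : List (Option Bool)) (reply : ℕ → ℕ)
      (hreply : ∀ i, L[i]? = some none → (L.set i (some false))[reply i]? = some none)
      (hstep : ∀ i, L[i]? = some none →
        Forces P ((L.set i (some false)).set (reply i) (some true)))
      (hfinal : ∀ M : List Bool, L = M.map some → P M) : Forces P L

/-- The replies in `Forces` form a function, so that its induction hypothesis covers every reply; by
choice it suffices to find one reply at a time. -/
theorem Forces.of_exists {P : List Bool → Prop} {L : List (Option Bool)}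
    (h : ∀ i, L[i]? = some none → ∃ j, (L.set i (some false))[j]? = some none ∧
      Forces P ((L.set i (some false)).set j (some true)))
    (hfinal : ∀ M : List Bool, L = M.map some → P M) : Forces P L := by
  classical
  choose! r h1 h2 using h
  exact .intro L r h1 h2 hfinal

theorem Forces.mono {P Q : List Bool → Prop} {L : List (Option Bool)} (h : Forces P L)
    (hPQ : ∀ M, P M → Q M) : Forces Q L := by
  induction h with
  | intro L r h1 _ h3 ih => exact .intro L r h1 ih fun M hM => hPQ M (h3 M hM)

/-- The second player can play on two lists at the same time. -/
theorem Forces.append {P Q R : List Bool → Prop} (hR : ∀ M N, P M → Q N → R (M ++ N))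
    {K L : List (Option Bool)} (hK : Forces P K) (hL : Forces Q L) : Forces R (K ++ L) := by
  induction hK generalizing L with
  | intro K r h1 h2 h3 ihK =>
    have hK := Forces.intro K r h1 h2 h3
    induction hL with
    | intro L r' h1' h2' h3' ihL =>
      have hL := Forces.intro L r' h1' h2' h3'
      -- The reply stays in the list of the move, so the other list keeps its strategy unchanged
      -- with the first player to move; hence the double induction.
      refine .of_exists (fun i hi => ?_) fun M hM => ?_
      · rcases lt_or_ge i K.length with h | h
        · rw [List.getElem?_append_left h] at hi
          have hj := h1 i hi
          have hlt : r i < K.length := by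
            have := (List.getElem?_eq_some_iff.1 hj).1
            simpa using this
          refine ⟨r i, ?_, ?_⟩
          · rw [List.set_append_left _ _ h, List.getElem?_append_left (by simpa using hlt), hj]
          · rw [List.set_append_left _ _ h, List.set_append_left _ _ (by simpa using hlt)]
            exact ihK i hi hL
        · rw [List.getElem?_append_right h] at hi
          refine ⟨K.length + r' (i - K.length), ?_, ?_⟩
          · rw [List.set_append_right _ _ h, List.getElem?_append_right (by omega),
              Nat.add_sub_cancel_left, h1' _ hi]
          · rw [List.set_append_right _ _ h, List.set_append_right _ _ (by omega),
              Nat.add_sub_cancel_left]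
            exact ihL _ hi
      · obtain ⟨M₁, M₂, rfl, rfl, rfl⟩ := List.append_eq_map_iff.1 hM
        exact hR _ _ (h3 _ rfl) (h3' _ rfl)

/-- Only an inequality, because the pair at the seam may or may not be counted. -/
theorem cnt_append (s : Bool) (M N : List Bool) : cnt s M + cnt s N ≤ cnt s (M ++ N) := by
  induction M with
  | nil => simp [cnt]
  | cons a M ih =>
    cases M with
    | nil => cases N <;> simp [cnt]
    | cons b M => simp only [cnt, List.cons_append] at ih ⊢; omega

theorem Forces.cnt_append {s : Bool} {t u : ℕ} {K L : List (Option Bool)}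
    (hK : Forces (fun M => t ≤ cnt s M) K) (hL : Forces (fun M => u ≤ cnt s M) L) :
    Forces (fun M => t + u ≤ cnt s M) (K ++ L) :=
  hK.append (fun M N hM hN => (add_le_add hM hN).trans (BalanceGame.cnt_append s M N)) hL

theorem count_none_set {L : List (Option Bool)} {i : ℕ} (hi : L[i]? = some none) (b : Bool) :
    (L.set i (some b)).count none + 1 = L.count none := by
  obtain ⟨h, hn⟩ := List.getElem?_eq_some_iff.1 hi
  have : 0 < L.count none := List.count_pos_iff.2 (List.mem_of_getElem? hi)
  rw [List.count_set h, hn]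
  simp
  omega

/-! ### Pairing strategies and their verification. -/

/-- If the unlabelled entries are matched in pairs by `f`, the second player can force the two
labels of every pair to be different. -/
theorem forces_of_pairing {P : List Bool → Prop} (f : ℕ → ℕ) (L : List (Option Bool))
    (hf : ∀ i : ℕ, L[i]? = some none → L[f i]? = some none ∧ f i ≠ i ∧ f (f i) = i)
    (hP : ∀ M : List Bool, M.length = L.length →
      (∀ (i : ℕ) (b : Bool), L[i]? = some (some b) → M[i]? = some b) →
      (∀ i : ℕ, L[i]? = some none → M[i]? ≠ M[f i]?) → P M) : Forces P L := by
  induction hk : L.count none using Nat.strong_induction_on generalizing L with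
  | _ k ih =>
    subst hk
    refine .of_exists (fun i hi => ?_) fun M hM => ?_
    · obtain ⟨h1, h2, h3⟩ := hf i hi
      have hil := (List.getElem?_eq_some_iff.1 hi).1
      have hfl := (List.getElem?_eq_some_iff.1 h1).1
      have hget : ∀ k, ((L.set i (some false)).set (f i) (some true))[k]? =
          if k = f i then some (some true) else if k = i then some (some false) else L[k]? := by
        intro k
        grind
      -- The reply is the partner. As `f` is an involution on unlabelled entries, it still matches
      -- those that remain.
      refine ⟨f i, by grind, ih _ ?_ _ ?_ ?_ rfl⟩
      · have e1 := count_none_set hi false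
        have e2 := count_none_set (L := L.set i (some false)) (i := f i) (by grind) true
        omega
      · intro k hk
        rw [hget] at hk
        split_ifs at hk with a b
        · cases hk
        · cases hk
        obtain ⟨u, v, w⟩ := hf k hk
        refine ⟨?_, v, w⟩
        rw [hget, if_neg, if_neg, u]
        · intro h; apply a; rw [← h, w]
        · intro h; apply b; rw [← w, h, h3]
      · intro M hl hM1 hM2
        have hMi : M[i]? = some false := hM1 i false (by rw [hget]; simp [h2.symm])
        have hMf : M[f i]? = some true := hM1 (f i) true (by rw [hget]; simp)
        refine hP M (by simpa using hl) (fun k b hk => hM1 k b ?_) fun k hk => ?_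
        · rw [hget, if_neg, if_neg, hk]
          · rintro rfl; rw [hi] at hk; cases hk
          · rintro rfl; rw [h1] at hk; cases hk
        · by_cases a : k = i
          · rw [a, hMi, hMf]; simp
          · by_cases b : k = f i
            · rw [b, h3, hMi, hMf]; simp
            · exact hM2 k (by rw [hget, if_neg b, if_neg a, hk])
    · subst hM
      refine hP M (by simp) (fun i b h => ?_) fun i h => ?_
      · simpa using h
      · simp at h

/-- The number of pairs counted by `cnt s` that are still needed when `t` of them are needed after
the entry `a` and the next entry is `b`. -/
def needed (s : Bool) (t : ℕ) (b : Bool) : Option Bool → ℕ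
  | none => t
  | some a => bif xor (xor a b) s then t.pred else t

/-- Whether every completion of the last `n` entries `L` of a list of length `T`, which follow an
entry `a`, has at least `t` pairs counted by `cnt s`, if the unlabelled entries with indices `k` and
`f k` get different labels. -/
def pairingBound (s : Bool) (f : ℕ → ℕ) (T : ℕ) : ℕ → Option Bool → ℕ → List (Option Bool) → Bool
  | 0, _, t, _ => Nat.beq t 0
  -- Enough pairs have been found, so the completions need not be enumerated further.
  | _, _, 0, _ => true
  | _, _, _, [] => false
  | n + 1, a, t, some b :: L => pairingBound s f T n (some b) (needed s t b a) L
  | n + 1, a, t, none :: L =>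
    -- The current index is `T - (n + 1)`. Its partner must come later, since an earlier partner
    -- would already have filled this entry.
    Nat.blt (Nat.sub T n.succ) (f (Nat.sub T n.succ)) &&
      (pairingBound s f T n (some false) (needed s t false a)
          (L.set (Nat.sub (f (Nat.sub T n.succ)) (Nat.sub T n)) (some true)) &&
        pairingBound s f T n (some true) (needed s t true a)
          (L.set (Nat.sub (f (Nat.sub T n.succ)) (Nat.sub T n)) (some false)))

theorem le_cnt_of_needed {s : Bool} {t : ℕ} {b : Bool} {a : Option Bool} {N : List Bool}
    (h : needed s t b a ≤ cnt s (b :: N)) : t ≤ cnt s (a.toList ++ b :: N) := by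
  cases a with
  | none => simpa [needed] using h
  | some a =>
    cases s <;> cases a <;> cases b <;> simp [needed, cnt] at h ⊢ <;> omega

/-- Here `L` is what is known of the last `n` entries of a final labelling `M`, and `a` is the entry
before them. Reading the next entry of `M` selects a branch of the enumeration and determines the
partner's label, which is recorded in `L`. -/
theorem le_cnt_of_pairingBound {s : Bool} {f : ℕ → ℕ} {M : List Bool} (n : ℕ) :
    ∀ (a : Option Bool) (t : ℕ) (L : List (Option Bool)), pairingBound s f M.length n a t L = true →
      L.length = n → n ≤ M.length →
      (∀ (k : ℕ) (b : Bool), L[k]? = some (some b) → M[M.length - n + k]? = some b) →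
      (∀ k : ℕ, L[k]? = some none →
        M[M.length - n + k]? ≠ M[f (M.length - n + k)]? ∧ f (M.length - n + k) < M.length) →
      t ≤ cnt s (a.toList ++ M.drop (M.length - n)) := by
  induction n with
  | zero =>
    intro a t L h _ _ _ _
    have : t = 0 := by simpa [pairingBound] using h
    simp [this]
  | succ n ih =>
    intro a t L h hL hn h1 h2
    rcases Nat.eq_zero_or_pos t with rfl | ht
    · exact Nat.zero_le _
    obtain ⟨t, rfl⟩ : ∃ u, t = u + 1 := ⟨t - 1, by omega⟩
    have e : M.length - (n + 1) + 1 = M.length - n := by omega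
    have e' (k : ℕ) : M.length - n + k = M.length - (n + 1) + (k + 1) := by omega
    have hi : M.length - (n + 1) < M.length := by omega
    rw [List.drop_eq_getElem_cons hi, e]
    match L, hL with
    | some b :: L, hL =>
      have hb : M[M.length - (n + 1)] = b := by
        have := h1 0 b rfl
        simpa [List.getElem?_eq_getElem hi] using this
      rw [hb]
      refine le_cnt_of_needed (ih (some b) _ L h (by simpa using hL) (by omega) ?_ ?_)
      · intro k c hk; rw [e']; exact h1 (k + 1) c hk
      · intro k hk; rw [e']; exact h2 (k + 1) hk
    | none :: L, hL =>
      simp only [pairingBound, Bool.and_eq_true, Nat.blt_eq, Nat.sub_eq] at h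
      obtain ⟨hlt, h⟩ := h
      obtain ⟨hne, hf⟩ := h2 0 rfl
      rw [Nat.add_zero] at hne hf
      rw [List.getElem?_eq_getElem hi, List.getElem?_eq_getElem hf] at hne
      have key : ∀ b : Bool, M[M.length - (n + 1)] = b →
          pairingBound s f M.length n (some b) (needed s (t + 1) b a)
            (L.set (f (M.length - (n + 1)) - (M.length - n)) (some !b)) = true →
          t + 1 ≤ cnt s (a.toList ++ b :: M.drop (M.length - n)) := by
        intro b hb h
        refine le_cnt_of_needed (ih (some b) _ _ h (by simpa using hL) (by omega) ?_ ?_)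
        · intro k c hk
          rw [List.getElem?_set] at hk
          split_ifs at hk with hk1 hk2
          -- The test that the partner comes later makes this subtraction exact.
          · rw [← hk1, Nat.add_sub_cancel' (by simp only [Nat.succ_eq_add_one] at hlt; omega),
              List.getElem?_eq_getElem hf]
            simp only [Option.some.injEq] at hk ⊢
            rw [hb] at hne
            rw [← hk]
            revert hne
            cases b <;> simp
          · rw [e']; exact h1 (k + 1) c hk
        · intro k hk
          rw [List.getElem?_set] at hk
          split_ifs at hk with hk1 hk2
          · simp at hk
          · rw [e']; exact h2 (k + 1) hk
      cases hb : M[M.length - (n + 1)]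
      · exact key false hb h.1
      · exact key true hb h.2

/-! ### Strategy trees and a checker for them. -/

/-- The `i`-th hexadecimal digit of `c`. -/
def hexDigit (c i : ℕ) : ℕ := Nat.mod (Nat.shiftRight c (Nat.mul 4 i)) 16

/-- The indices of the unlabelled entries of a list whose first index is `i`. -/
def unlabelled : ℕ → List (Option Bool) → List ℕ
  | _, [] => []
  | i, none :: L => i :: unlabelled (i + 1) L
  | i, some _ :: L => unlabelled (i + 1) L

/-- Whether the `i`-th entry exists and is unlabelled. -/
def isUnlabelled : List (Option Bool) → ℕ → Bool
  | none :: _, 0 => true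
  | _ :: L, i + 1 => isUnlabelled L i
  | _, _ => false

/-- Whether `f` matches the unlabelled entries in pairs. -/
def isPairing (f : ℕ → ℕ) (L : List (Option Bool)) : Bool :=
  (unlabelled 0 L).all fun i => isUnlabelled L (f i) && (!Nat.beq (f i) i && Nat.beq (f (f i)) i)

theorem isUnlabelled_iff {L : List (Option Bool)} {i : ℕ} :
    isUnlabelled L i = true ↔ L[i]? = some none := by
  induction L generalizing i with
  | nil => simp [isUnlabelled]
  | cons a L ih => cases i <;> cases a <;> simp [isUnlabelled, ih]

theorem mem_unlabelled {L : List (Option Bool)} {i j : ℕ} :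
    j ∈ unlabelled i L ↔ i ≤ j ∧ L[j - i]? = some none := by
  induction L generalizing i with
  | nil => simp [unlabelled]
  | cons a L ih =>
    rcases lt_trichotomy j i with h | rfl | h
    · cases a <;> simp [unlabelled, ih] <;> omega
    · cases a <;> simp [unlabelled, ih]
    · have e : j - i = j - (i + 1) + 1 := by omega
      cases a <;> simp [unlabelled, ih, e, h.le, h.ne', Nat.succ_le_of_lt h]

theorem mem_unlabelled_zero {L : List (Option Bool)} {j : ℕ} :
    j ∈ unlabelled 0 L ↔ L[j]? = some none := by simp [mem_unlabelled]

theorem forces_of_pairingBound {s : Bool} {t : ℕ} {f : ℕ → ℕ} {L : List (Option Bool)}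
    (hf : isPairing f L = true) (h : pairingBound s f L.length L.length none t L = true) :
    Forces (fun M => t ≤ cnt s M) L := by
  have hf' : ∀ i : ℕ, L[i]? = some none → L[f i]? = some none ∧ f i ≠ i ∧ f (f i) = i := by
    intro i hi
    have := List.all_eq_true.1 hf i (mem_unlabelled_zero.2 hi)
    simp only [Bool.and_eq_true, Bool.not_eq_true', isUnlabelled_iff] at this
    exact ⟨this.1, Nat.ne_of_beq_eq_false this.2.1, Nat.eq_of_beq_eq_true this.2.2⟩
  refine forces_of_pairing f L hf' fun M hM h1 h2 => ?_
  rw [← hM] at h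
  have := le_cnt_of_pairingBound M.length none t L h hM.symm le_rfl
    (by simpa using h1) (fun k hk => ?_)
  · simpa using this
  · simp only [Nat.sub_self, Nat.zero_add]
    refine ⟨h2 k hk, ?_⟩
    have := (List.getElem?_eq_some_iff.1 (hf' k hk).1).1
    omega

/-- Checks a strategy of the second player that forces `t` pairs counted by `cnt s`. For each
position reached, and each move of the first player there, an entry `c` of the list has the reply as
its last hexadecimal digit. The other digits are those of a pairing for the new position, or `0` if
the entries that follow describe how the second player goes on. -/
def checkStrategy (s : Bool) (t : ℕ) : ℕ → List (Option Bool) → List ℕ → Option (List ℕ)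
  | 0, _, _ => none
  | n + 1, L, cs =>
    -- Branches end in pairings, possibly empty ones. A full list is rejected, so the condition on
    -- final labellings in `Forces` is vacuous for an accepted list.
    bif (unlabelled 0 L).isEmpty then none else
    -- The table lists the tree in preorder; the state of the fold is the part of the table not yet
    -- read, or `none` after a failure.
    (unlabelled 0 L).foldl (fun st i => st.bind fun cs => match cs with
      | [] => none
      | c :: cs =>
        let K := (L.set i (some false)).set (Nat.mod c 16) (some true)
        bif isUnlabelled (L.set i (some false)) (Nat.mod c 16) then
          bif Nat.beq (Nat.div c 16) 0 then checkStrategy s t n K cs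
          else bif isPairing (hexDigit (Nat.div c 16)) K &&
            pairingBound s (hexDigit (Nat.div c 16)) K.length K.length none t K then some cs
          else none
        else none) (some cs)

/-- Failure is absorbing, so success at the end means success at each step, with some intermediate
state. -/
theorem foldl_bind_isSome {α β : Type*} (g : β → α → Option β) (l : List α) {o : Option β}
    (h : (l.foldl (fun st i => st.bind fun b => g b i) o).isSome = true) :
    o.isSome = true ∧ ∀ i ∈ l, ∃ b, (g b i).isSome = true := by
  induction l generalizing o with
  | nil => simpa using h
  | cons i l ih =>
    obtain ⟨h1, h2⟩ := ih (by simpa using h)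
    cases o with
    | none => simp at h1
    | some b => exact ⟨rfl, List.forall_mem_cons.2 ⟨⟨b, h1⟩, h2⟩⟩

/-- Soundness does not depend on how the table is divided among the branches: whatever part a branch
reads, its success certifies that branch. -/
theorem forces_of_checkStrategy {s : Bool} {t : ℕ} (n : ℕ) : ∀ (L : List (Option Bool))
    (cs : List ℕ), (checkStrategy s t n L cs).isSome = true → Forces (fun M => t ≤ cnt s M) L := by
  induction n with
  | zero => intro L cs h; simp [checkStrategy] at h
  | succ n ih =>
    intro L cs h
    rw [checkStrategy] at h
    cases he : (unlabelled 0 L).isEmpty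
    · rw [he, cond_false] at h
      refine .of_exists (fun i hi => ?_) fun M hM => ?_
      · obtain ⟨cs, hcs⟩ := (foldl_bind_isSome _ _ h).2 i (mem_unlabelled_zero.2 hi)
        cases cs with
        | nil => simp at hcs
        | cons c cs =>
          refine ⟨Nat.mod c 16, ?_, ?_⟩
          · by_contra hc
            rw [← isUnlabelled_iff, Bool.not_eq_true] at hc
            simp [hc] at hcs
          · cases h1 : isUnlabelled (L.set i (some false)) (Nat.mod c 16)
            · simp only [h1, cond_false] at hcs; simp at hcs
            simp only [h1, cond_true] at hcs
            cases h2 : Nat.beq (Nat.div c 16) 0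
            · simp only [h2, cond_false] at hcs
              rw [Bool.cond_eq_ite] at hcs
              split_ifs at hcs with h3
              · rw [Bool.and_eq_true] at h3
                exact forces_of_pairingBound h3.1 h3.2
              · simp at hcs
            · simp only [h2, cond_true] at hcs
              exact ih _ _ hcs
      · subst hM
        obtain ⟨i, l, hl⟩ := List.exists_cons_of_ne_nil (l := unlabelled 0 (M.map some))
          (by rintro h; simp [h] at he)
        have : i ∈ unlabelled 0 (M.map some) := by simp [hl]
        simp [mem_unlabelled_zero] at this
    · simp [he] at h

/-! ### Strategy tables for blocks of 16 and 14 vertices. -/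

/-- A strategy on 16 unlabelled vertices that forces 6 edges with equal ends, for
`checkStrategy`. -/
def equalStrategy16 : List ℕ := [
  0xf, 0xcae9db6483750002, 0xcae9db6480710305, 0xcae9db6480701205, 0xcae9db6587010302,
  0xcae9db3140680702, 0xcae9db3507180402, 0xcae9db5048610302, 0xcae6d709b3150402,
  0xc7e680adb3150402, 0xcbed075948610302, 0x97a0ce6d83150402, 0x9b0d7e6a83150402,
  0xb0aec75948610302, 0x3, 0xb9d8ca547600002, 0x4, 0xbadc89670000005, 0x8, 0xbadc70900000006,
  0xb9d1c0000000a07, 0xbadc00010000609, 0xb6d1000c0000a07, 0xb9d0c0010000607, 0xcd0160090000a07,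
  0xb0d160090000a07, 0xa9cb0010000607, 0xb9d8ca100000705, 0xb9d8ca010000605, 0xbadc60190000705,
  0x8a6c0d1b0000705, 0xb8d07c910000605, 0xcd086a190000705, 0xb0d86a190000705, 0xa8c7b910000605,
  0xb9d8ca517000602, 0xb9d8ca670100402, 0xb9d8ca507100402, 0xb9d8ca056100402, 0xbadc60597100402,
  0x8a6c0d5b7100402, 0xb8d07c956100402, 0xcd086a597100402, 0xb0d86a597100402, 0xa8c7b956100402, 0x4,
  0xdbfaec76982005003, 0xdbfaec75908000063, 0x5, 0xdbfaec72900008006, 0xdbfaec76980000000, 0x9,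
  0xdbfaec00200007008, 0xdbf7e80ac00000000, 0xdbfaec00000000028, 0xdbf0e0002000070ca,
  0xd7f02000e0000b0c8, 0xdcfe0700a00000028, 0xa7b0df00e00000028, 0xac0e7f00b00000028,
  0xc0bfd700a00000028, 0xcae2d0000000b078, 0xdbfaec02000008096, 0xdbfaec70900000026,
  0xdbf7e80ac00000026, 0xd8f790bec00000026, 0xdcfe087a900000026, 0xa8b0df7e900000026,
  0xac0e8f7b900000026, 0xc0bfd87a900000026, 0xcae9db2000008076, 0xdbfaec72900008063,
  0xdbfaec75908000023, 0xdbfaec52009008063, 0xdbfaec70902005063, 0xdbfaec06587000023,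
  0xd8f790bec02005063, 0xac8e0f7d902005063, 0xdaf09eb6587000023, 0xac0e8f7b902005063,
  0xd0fa8c7b902005063, 0xcae9db6587000023, 0x5, 0xdbfaec74900810306, 0xdbfaec76980000034,
  0xdbfaec76980100400, 0x6, 0xdbfaec89000010307, 0xdbfaec89000000037, 0xdbfaec89100000700, 0xa,
  0xdcfe800b000010309, 0xdcfe800b000000039, 0xdcfe90b1000000800, 0xdbf3e0100000c0900,
  0xd1f00003000080ecb, 0xd8f0000e0000103c9, 0xdbf0e013000080900, 0xb103f0000000c0e89,
  0x308190bd0000f0c00, 0xcbed013000080900, 0xdbfaec30100090700, 0xdbfaec03100080700,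
  0xdcfe1030000090b87, 0xd9f308ea1000c0700, 0xdaf09eb3100080700, 0x9b03e1f00000c0a87,
  0x30b9d8ca1000f0700, 0xcae9db3100080700, 0xdbfaec03100080794, 0xdbfaec61090000834,
  0xdbfaec70900010364, 0xdbfaec03140680700, 0xdcfe1076980000b34, 0xac8e0f7d900010364,
  0xdaf09eb3140680700, 0xb10afc76980000e34, 0xd0fa8c7b900010364, 0xcae9db3140680700, 0xb,
  0xd9f008ea54760120c, 0xd9f608ea0c0204057, 0xdcfe086a597100400, 0xdcfe086a192005700,
  0xd9f008ea2406070c1, 0xd9f008ea5072040c1, 0xdcfe0152049608a00, 0xd6f005709ea2040c1,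
  0xdaf00e065872040c1, 0xd8f0007e9426050c1, 0xa, 0x5840007e90fd01206, 0x5840007e90fd00026,
  0xd8f0007e956100400, 0xd8f0007e912005600, 0xd8f0007e910204600, 0xd8f0001e507204900,
  0xd9f000e2041608500, 0xd9f000e0241607500, 0x6, 0x7480000df00e01205, 0x7480000df00e00025,
  0xd8f0000e507100400, 0xd7f00002e01008500, 0x2400001000d0e8f7, 0x280000d00010e4f5,
  0xd7f00000e01204500, 0x4800000e200f07051, 0x4080000d200f07051, 0xde00002000108475,
  0xef000075918204600, 0xd0f00075918204600, 0xde00075918204600, 0x640908ca0f2e05071,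
  0xd0f0086a5972040c1, 0x29108da54760ec00, 0x7, 0xdbfaec89002015306, 0xdbfaec35008090026,
  0xdbfaec05008010396, 0xdbfaec52009008061, 0xdbfaec31020096800, 0x8, 0xdbfaec00003051209,
  0xdbfaec00003050029, 0xdbfaec10003050900, 0xdbfaec10002005900, 0xdbfaec30000091200, 0xc,
  0xdbf0e50000a010302, 0xdaf00e0000305002b, 0xa1b0df00003050e00, 0x2b10e50000a00fd00,
  0xa3b0df000000e1200, 0x5310200000f0ebd00, 0x310050000a0e0df2, 0x3500010000e0f0a2b,
  0x5020130000f0adb00, 0x520130000e0adb00, 0xd9f350e000b0c0021, 0x5c2e031000f0ad900,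
  0xdaf02e1000305b900, 0x350a9cb000e0f0021, 0x503a2c1000f0db900, 0xcae2d1000305b900,
  0xdbfaec30001090526, 0xdbfaec02013058600, 0xdbf8e03c001090526, 0xd9f305e608a0c0021,
  0xdaf09eb2013058600, 0xac0e8f3b001090526, 0x30b9d5c608a0f0021, 0xcae9db2013058600, 0x8,
  0xd6f241300e0b9ca07, 0xdbfaec70900204063, 0xdbfaec00040610397, 0xdbfaec00240607091,
  0xdbfaec20130069700, 0xdbfaec70900214300, 0x9, 0xdbfaec00040610302, 0xdbfaec00000204063,
  0xdbf4e000010c0063a, 0xdbf2e10004060ca00, 0xdbf2e10003006ca00, 0xdbf4e300000ca1200, 0x2,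
  0xdcfe60000b0100403, 0xd4f060000b0e000c3, 0xdbf0e0000406000c1, 0xdcfe60000b0000031,
  0xdcfe4000000b10300, 0x6c4e00000f0d10300, 0xd4f060000b0e10300, 0xc60f40000e0b00031,
  0x60b4d0000f0c10300, 0x6b4d0000e0c10300, 0xdaf60e000c0214300, 0xdaf06e000b0214300,
  0xb03e2000406ca0f1, 0x60badc000f0214300, 0xcae6d000b0214300, 0xdbf3e400010ac0627,
  0xdbf0e0302406970c1, 0x6c3e04200f0ad9071, 0xdaf06e709b0214300, 0xac0e3f002406b7091,
  0x604a3c200f0db9071, 0xcae6d709b0214300, 0x9, 0xdbfaec03507180402, 0xdbfaec00403750028,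
  0xdbf7e80ac03150400, 0xdbfaec00507100428, 0xdbf0e103507080ac2, 0xdbf7e80ac00214300,
  0xdbf5e40200ca18300, 0xa, 0x3524000010ecfd70b, 0xdbf0e0005072040c3, 0xdbf7e000c03150400,
  0xd5f0000020e1074cb, 0x3c2e10005070fdb00, 0xdbf7e000c00214300, 0x5c4e300000fdb1200, 0x3,
  0xdcfe0000507100402, 0xd4f00000507e000c2, 0xd5f0000010e0007c4, 0xd1f00000507000ec2,
  0x7c4e0000f00d01200, 0x5c4e000000fd01200, 0xd4f00000507e01200, 0x5070000c0e2040f1,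
  0xd0f000005071004c2, 0xc4e0000507d01200, 0xdbf0e000507214300, 0x35074000c0ebf0021,
  0x70524000f0db1c300, 0xcbed000507214300, 0xd7f35000e0b1c0428, 0xdaf70e00c03254081,
  0x4705301d0bea08f2, 0x3507480ac0ebf0021, 0x70badc00f03254081, 0xc7e5300d0b1a0428, 0x4,
  0xdbfaec31020096805, 0xdbfaec52009008063, 0xdbfaec61090000835, 0xdbfaec02010008695, 0x3,
  0xdbfaec16080000902, 0xdbfaec06080000092, 0xa, 0xdcfe800b010000609, 0xdcfe800b000000069,
  0xdcfe90b1000000800, 0xdbf6e0100c0000900, 0xd1f00006080000ecb, 0xd8f0000e0100006c9,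
  0xdbf0e016080000900, 0xb106f0000c0000e89, 0x608190bd0f0000c00, 0xcbed016080000900,
  0xdbfaec89000001200, 0xdbfaec60090001200, 0xdbfaec06080001200, 0x96b1d0f00e0000c82,
  0xd9f608ea0c0001200, 0xdaf09eb6080001200, 0x9b06e1f00c0000a82, 0x60b9d8ca0f0001200,
  0xcae9db6080001200, 0xdbfaec89002015300, 0xdbfaec60092015300, 0xdbfaec06082015300,
  0xd9f060e10b20058c3, 0xd9f608ea0c2015300, 0xdaf09eb6082015300, 0xac0e1f06082005b93,
  0x60b9d8ca0f2015300, 0xcae9db6082015300, 0x5, 0xdbfaec20130069704, 0xdbfaec00240607093,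
  0xdbfaec70900010364, 0xdbfaec70900204061, 0xdbfaec30100090726, 0x4, 0xdbfaec20100009703,
  0xdbfaec70900000023, 0xdbfaec70900010300, 0xb, 0xdaf00e7090000120c, 0xdcfe000020000709a,
  0xdcfe0170900000a00, 0xdcfe0120000009a00, 0xdcfe0100200007a00, 0xd2f0007090000e0c1,
  0x2700010d0000e9fa, 0x970200f0e0000c0a1, 0x907200f0d0000c0a1, 0x2a10d7090000ec00,
  0xdcfeab20000019300, 0xdbfaec00200017300, 0xdcfe207090001b300, 0xdaf70e20c00019300,
  0xdaf09eb0200017300, 0xef0792b0c0001a300, 0x70badc20f00019300, 0xcae9db0200017300,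
  0xd6f241300e0b9ca00, 0xdbfaec00240617300, 0x79b3d0e0f002c4061, 0xdaf70e30c00294061,
  0xdaf09eb0240617300, 0xb907f3e0c002a4061, 0x70badc30f00294061, 0xcae9db0240617300, 0x6,
  0xdbf7e80ac03150402, 0xdbf3e80a4007c0025, 0xdbfaec03507180400, 0xdbf7e80ac00100425,
  0xdbfaec03102085700, 0xdbf3e401000ac0827, 0x5, 0xdbf3e2010000ca804, 0xdbf3e80a0000c0024,
  0xdbfaec03000180400, 0xdbfaec02000108400, 0xc, 0xdbf0e80a000010302, 0xdaf00e0300008002b,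
  0xa1b0df03000080e00, 0x2b10e80a00000fd00, 0xa3b0df000000e1200, 0x8310200f0000ebd00,
  0x310080a0000e0df2, 0x3800010e0000f0a2b, 0x8020130f0000adb00, 0x820130e0000adb00,
  0xdbfaec00000341200, 0x8241300f000dbec00, 0x2413080a000ecfd00, 0xb80e30d0002a40f1,
  0x380a4c0e000bf0021, 0x8024130f000cadb00, 0x824130e000cadb00, 0xdbfaec00403751200,
  0xd4f3800b507ec0021, 0xd7f0080ae031504c2, 0xb80e40d103a507f2, 0x380a4c0e507bf0021,
  0x8035240f00cadb071, 0xcbed80a003150427, 0x4, 0xd8f3107e9200c6b05, 0xd8f790bec02005063,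
  0xdcfe1076980000b35, 0xd8f0207e91000b6c5, 0x3, 0xd8f790bec10000602, 0xd8f790bec00000062, 0xd,
  0xef00807b91000060c, 0x80790bec000000f6, 0xbc0ef071900000800, 0x9b00e0f001000068c,
  0x7b00e010f0000096c, 0xbc0ef006180000700, 0x970800fce10000600, 0x90b61800007fe,
  0x6000801b0f000097c, 0x80790bec10000600, 0xdcfe807b900001200, 0x96b1d0f00e0000c82,
  0x79b1d0e0f00000c62, 0xdcfe7006b80001200, 0x9c7e00f6d80001200, 0xd7f090b6e80001200,
  0x7c0e90b1f00000862, 0x90b7d0f6c80001200, 0x9b7d0e6c80001200, 0xdcfe807b902015300,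
  0xd9f060e10b20058c3, 0x79b1d0e0f02005c63, 0xdcfe7006b82015300, 0x9c7e00f6d82015300,
  0xd7f090b6e82015300, 0x7c0e90b1f02005863, 0x90b7d0f6c82015300, 0x9b7d0e6c82015300, 0x3,
  0xdcfe086a597100402, 0xd9f008ea5476000c2, 0x4, 0xdcfe086a190000705, 0xac8e0f7d900000065, 0x8,
  0xdcfe0160090000a07, 0xdaf00e709000000c6, 0xac9e0fd0100000700, 0xdaf00e000100006c9,
  0xd6f001000e0000ac7, 0xd9f600e01c0000700, 0xdaf00e70910000600, 0x910a0cf0000000e67,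
  0xd0fa0c00010000697, 0xcae0d70910000600, 0xac8e0f7d901000500, 0xd9f608ea0c1000500,
  0xdaf70e10c00000965, 0xac7e0f06d81000500, 0x9c7e00f6d81000500, 0xd9f008ea671000500,
  0xac0e0f71900000865, 0xd0fa0c71900000865, 0xc9e08da671000500, 0xd9f008ea5170006c2,
  0xac8e0f7d900100462, 0xd9f705e0c0a100482, 0xd9f608ea0c0204051, 0xdaf70e50c09100462,
  0x7c5e080af0d100462, 0x9c7e00f6d80204051, 0xd9f008ea547601200, 0xac0e0f75908100462,
  0xd0fa0c75908100462, 0xc9e08da547601200, 0x4, 0x2a109eb658700fd03, 0xdaf09eb6587000023,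
  0xdaf09eb6587010300, 0x5, 0xa8b0df7e900001206, 0xa8b0df7e900000026, 0xdaf09eb7810000600, 0x9,
  0xa7b0df00e00001208, 0xa7b0df00e00000028, 0xdbf0e80a100000700, 0xdaf02e0100000b800,
  0x2701000d0000ebfa, 0x2b0d00010000e7f8, 0xdaf00e01200007800, 0x7b00e200f0000a081,
  0x70b0d200f0000a081, 0xde0200010000b7a8, 0xdaf09eb2010008600, 0xdaf09eb0210007600,
  0xdbf0e702a10008600, 0xd7f090b2e10008600, 0xd9f008ea210007600, 0xef0097b2a10008600,
  0xd0f097b2a10008600, 0xde097b2a10008600, 0xdaf09eb6280017300, 0xdaf09eb7802015300,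
  0xdaf09eb6082015300, 0xdaf09eb0672015300, 0xdbf0e706a82015300, 0xd7f090b6e82015300,
  0xd9f008ea672015300, 0xef0097b6a82015300, 0xd0f097b6a82015300, 0xde097b6a82015300, 0x7,
  0x640a9cb00f2e15308, 0xac0e8f0b042605093, 0xb10afc35008090e46, 0xb0aec460829050f1,
  0xac0e8f3b001090526, 0xb0aec420309680f1, 0x350a9cb000e1f0428, 0x6, 0xac0e9fb0003150402,
  0xac0e4f00003b50092, 0x4b0aec10000f00935, 0xb904f2e0000c0a051, 0xac0e5f3000b090021, 0x2,
  0xac0e9fb0000100403, 0xac0e4f00000b00093, 0xb0aec400009000f1, 0xac0e9fb0000000031,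
  0xef0a4c00000b10300, 0xc90f40e0000b00031, 0xac0e0f40000900031, 0xef0094b0000a10300,
  0xc00f94b0000a10300, 0xc0e94b0000a10300, 0xef0a4c00003b51200, 0xc90f00e00031504b2,
  0xac0e0f00003150492, 0xef0094b0003a51200, 0xc00f94b0003a51200, 0xc0e94b0003a51200,
  0xef0a8c0b042615300, 0xc0e90b20416085f3, 0xac0e0f02041608593, 0xef0098ba042615300,
  0xc00f98ba042615300, 0xc0e98ba042615300, 0x3, 0xc0bfd86a597100402, 0xb9d8ca5476000f2, 0x4,
  0xc0bfd86a190000705, 0xd0fa8c7b900000065, 0x8, 0xc0bfd160090000a07, 0xbadc709000000f6,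
  0xd0fa9cb0100000700, 0xbadc000100006f9, 0xa0160f000c0000db7, 0x60b9d0c01f0000700,
  0xd0fa0c00010000697, 0xd0f061709b0000a00, 0x600a9cb01f0000700, 0xbadc70910000600,
  0xd0fa8c7b901000500, 0x60b9d8ca0f1000500, 0x70badc10f00000965, 0xd0fa7c06b81000500,
  0x90b7d0f6c81000500, 0xd0fa0c71900000865, 0xd0f097b6a81000500, 0xc00f97b6a81000500,
  0xb9d8ca671000500, 0xb9d8ca5170006f2, 0xd0fa8c7b900100462, 0x70b9d5c0f0a100482,
  0x60b9d8ca0f0204051, 0x70badc50f09100462, 0xd0f7580ac0b100462, 0x90b7d0f6c80204051,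
  0xd0fa0c75908100462, 0xa0b0df75908100462, 0xc00f97b6a80204051, 0xb9d8ca547601200, 0x0, 0x4,
  0xcae9db6587000003, 0x5, 0xcbed9a7800000006, 0x9, 0xcbed80a000000007, 0xcae2d0000000b008,
  0xcbed00020000700a, 0xc7e2000d0000b008, 0xcae0d00200007008, 0xde02700a0000b008,
  0xc0e2700a0000b008, 0xbadc00200007008, 0xcae9db2000008006, 0xcae9db0200007006, 0xcbed702a00008006,
  0x9b7d0e2c00008006, 0xc9e08da200007006, 0xde097b2a00008006, 0xc0e97b2a00008006, 0xb9d8ca200007006,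
  0xcae9db6280007003, 0xcae9db7802005003, 0xcae9db6082005003, 0xcae9db0672005003,
  0xcbed706a82005003, 0x9b7d0e6c82005003, 0xc9e08da672005003, 0xde097b6a82005003,
  0xc0e97b6a82005003, 0xb9d8ca672005003, 0xcae9db6483750001, 0xcae9db6587204001, 0xcae9db3527086001,
  0xcae9db6480723001, 0xcae9db7803254001, 0xcae9db6083254001, 0xcae9db0547623001,
  0xcbed706a83254001, 0x9b7d0e6c83254001, 0xc9e08da547623001, 0xde097b6a83254001,
  0xc0e97b6a83254001, 0xb9d8ca547623001]

/-- A strategy on 14 unlabelled vertices that forces 5 edges with equal ends, for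
`checkStrategy`. -/
def equalStrategy14 : List ℕ := [
  0x3, 0xb9d8ca547600002, 0x4, 0xbadc89670000005, 0x8, 0xbadc70900000006, 0xb9d1c0000000a07,
  0xbadc00010000609, 0xb6d1000c0000a07, 0xb9d0c0010000607, 0xcd0160090000a07, 0xb0d160090000a07,
  0xa9cb0010000607, 0xb9d8ca100000705, 0xb9d8ca010000605, 0xbadc60190000705, 0x8a6c0d1b0000705,
  0xb8d07c910000605, 0xcd086a190000705, 0xb0d86a190000705, 0xa8c7b910000605, 0xb9d8ca517000602,
  0xb9d8ca670100402, 0xb9d8ca507100402, 0xb9d8ca056100402, 0xbadc60597100402, 0x8a6c0d5b7100402,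
  0xb8d07c956100402, 0xcd086a597100402, 0xb0d86a597100402, 0xa8c7b956100402, 0x4, 0xb9d8ca672005003,
  0xb9d8ca537060000, 0x5, 0xb9d8ca200007006, 0xb9d8ca670000000, 0x9, 0xbadc00200007008,
  0x8a7c0db00000000, 0xbadc00000000028, 0xb0d0002000070ca, 0xb7d000c00000028, 0xcd0700a00000028,
  0xb0d700a00000028, 0xbc700a00000028, 0xb9d8ca000000026, 0xbadc70900000026, 0x8a7c0db00000026,
  0xb9d0c7800000026, 0xcd087a900000026, 0xb0d87a900000026, 0xa9cb7800000026, 0xb9d8ca200007063,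
  0xb9d8ca507000023, 0xb9d5c608a000023, 0xb6d5709ca000023, 0xbadc06587000023, 0x8690bd5c7000023,
  0x8a0c6d597000023, 0xa09db6587000023, 0xa8c7b902005063, 0x5, 0xb9d8ca130060704, 0xb9d8ca670000034,
  0xb9d8ca670100400, 0x6, 0xbadc89000010307, 0xbadc89000000037, 0xbadc89100000700, 0xa,
  0xcd800b000010309, 0xb9d0c3000080000, 0xcd90b1000000800, 0xb9d0c0000010300, 0xb1d003000080c00,
  0x1300000000c0d89, 0xb0d013000080900, 0x3800b0000c0019, 0xbadc30100090700, 0xbadc03100080700,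
  0x7930c1d000b0800, 0x9308da1000c0700, 0xa09db3100080700, 0xa8c3b000090017, 0xb9d8ca100000734,
  0xb9d4c3010a80600, 0xb9d6c01a0000734, 0xbadc03140680700, 0x48307c910db0600, 0x8a0c6d190000734,
  0xa09db3140680700, 0xa8c7b930060014, 0x0, 0xd, 0xa8c7b956000004, 0xa8c7b902005006,
  0xa8c7b900204006, 0xa8c0b507204009, 0xa9cb2040608005, 0xa9cb0240607005, 0x64702ac0b08005,
  0x6802b4c0709005, 0x908ca240607005, 0x6, 0x98ba507000004, 0x97b2a00008005, 0x98ba000204007,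
  0x94b2000a08005, 0x97b0a00204005, 0xab02400708005, 0x90b2400708005, 0x87a900204005,
  0xb9d8ca547600001, 0xb9d8ca672005001, 0xb9d8ca240607001, 0xb9d8ca507204001, 0xb9d5c608a204001,
  0xb6d5709ca204001, 0xbadc06587204001, 0x8690bd5c7204001, 0x8a0c6d597204001, 0xa09db6587204001,
  0xa8c7b942605001, 0x1, 0xb9d8ca537060002, 0x0, 0xb9d8ca670000005, 0xb9d8ca030060007,
  0xb9d8ca003050007, 0xb9d0c608305000a, 0xbadc30507090006, 0xbadc03507080006, 0x75803bd0c090006,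
  0x7903c5d080a0006, 0xa09db3507080006, 0x7, 0xa9cb6080000005, 0xa8c3b000090006, 0xa9cb0003050008,
  0xa5c3000b090006, 0xa8c0b003050006, 0xbc035008090006, 0xa0c35008090006, 0x98ba003050006,
  0xb9d8ca672005000, 0xb9d8ca230067000, 0xb9d8ca203057000, 0xb9d2c608305a000, 0xbadc30527096000,
  0xbadc03527086000, 0x8690bd2c3057000, 0x9308da5270c6000, 0xa09db3527086000, 0xa8c7b956000032, 0x2,
  0xb9d8ca670100403, 0xb9d8ca400700063, 0x1, 0x8, 0xbadc70900000006, 0xb9d4c0000a00007,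
  0xbadc00040600009, 0xb6d4000c0a00007, 0xb9d0c0040600007, 0xcd0460090a00007, 0xb0d460090a00007,
  0xa9cb0040600007, 0xbadc89670000000, 0xbadc89400700000, 0xbadc89040600000, 0xbadc70940600000,
  0xbadc07840600000, 0xcd807b940600000, 0x8a0c7d940600000, 0xa09db7840600000, 0xa8c7b940600000,
  0xb9d8ca130060700, 0xb9d8ca400710300, 0xb9d8ca040600031, 0xbadc70940600031, 0xbadc06480710300,
  0xb8d07c940600031, 0x8a0c7d940600031, 0xa09db6480710300, 0xa8c7b940600031, 0x0, 0xd,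
  0xa8c4b507900003, 0xa8c0b507204009, 0xa8c0b507023009, 0xa8c3b400790002, 0xa4c35008b90002,
  0xa9cb0507204003, 0x4850b20ac07003, 0x3507490b8c0002, 0x908ca507204003, 0x9, 0x780ab03050004,
  0x5700a0b204008, 0x5700a0b023008, 0x780ab00204003, 0x530400b8a0002, 0x30005072b400a,
  0x500030b274008, 0x403507a80002, 0xb9d8ca403750001, 0xb9d8ca507204001, 0xb9d8ca203057001,
  0xb9d8ca400723001, 0xb9d4c5008a23001, 0xbadc70903254001, 0xbadc07803254001, 0x48507c90bd23001,
  0x8a0c7d903254001, 0xa09db7803254001, 0xa8c7b903254001, 0x1, 0xb9d8ca043650002, 0x0,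
  0xb9d5c608a000004, 0xb9d0c608305000a, 0xb9d0c608034000a, 0xb9d4c5008a00003, 0xb5d46009ca00003,
  0xbadc06083050004, 0x5960c30bd080004, 0x46085a0c9d00003, 0xa09db6083050004, 0xa, 0x890bc040600005,
  0x6800b0c3050009, 0x6800b0c0340009, 0x890bc003050004, 0x640500c9b00003, 0x40006083c5000b,
  0x600040c3850009, 0x504608b900003, 0xb9d5c608a204000, 0xb9d2c608305a000, 0xb9d2c304068a000,
  0xb9d4c5008a23000, 0xb5d46009ca23000, 0xbadc06083254000, 0x5960c30bd284000, 0x46085a0c9d23000,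
  0xa09db6083254000, 0xa9cb5048600032, 0x0, 0xb9d0c053726400a, 0xb6d5709ca010304, 0xb6d5709ca204001,
  0xbadc30527096001, 0xb7d240c3096a001, 0xbadc70903254001, 0xb5d46009ca23001, 0xbadc00547623001,
  0x5790b0c3d264001, 0x5a0c7093d264001, 0xa09db0547623001, 0x1, 0x5, 0x796b0ca0000004,
  0xa7c30b00090006, 0x793b0c000a0004, 0xbc9a0030060004, 0xa7c00b40600003, 0xbc070930060004,
  0xa0c70930060004, 0x97b0a40600003, 0x795b0c4a600002, 0x796b0ca3050002, 0xa7c40b30960002,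
  0x795b0c0a340002, 0x695b00ca340002, 0xa7c00b56340002, 0xbc070943650002, 0xa0c70943650002,
  0x97b0a56340002, 0x1, 0x2, 0x6, 0x8a7c0db00000005, 0xb8d40c000a00007, 0x8a4c0d000b00005,
  0xcdab00400700005, 0xb8d00c507000004, 0xcd080a400700005, 0xb0d80a400700005, 0xa8c0b507000004,
  0x8a6c0d5b7000003, 0x8a7c0db40600003, 0xb8d50c40a700003, 0x8a6c0d0b4500003, 0x7a6c00db4500003,
  0xb8d00c674500003, 0xcd080a547600003, 0xb0d80a547600003, 0xa8c0b674500003, 0xbadc06483750000,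
  0xbadc06587204000, 0xbadc03527086000, 0xbadc06480723000, 0xbadc07803254000, 0xbadc06083254000,
  0xbadc00547623000, 0x75800bd4c623000, 0x7a0c06d83254000, 0xb0d706a83254000, 0xa7c06b83254000, 0x2,
  0xb8d07c943650001, 0x3, 0xb9d0c7856000004, 0x7, 0xb9d0c6080000005, 0x8690bd0c0000000,
  0xb9d0c0000000058, 0xb5d00000c000096, 0x68500c0db000000, 0x9000d60800000c5, 0x8090bd000000056,
  0xbc005008000096, 0xb8d07c900000064, 0x48507c90bd00000, 0xb9d0c5008000064, 0xb5d07090c000064,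
  0x75800bd4c600000, 0x7900c5d48600000, 0x7090b6d80000054, 0xbc075908000064, 0xb8d07c940600051,
  0xb8d07c956000031, 0xb8d07c940600031, 0x48507c90bd10300, 0xb9d0c5048600031, 0xb5d07094c600031,
  0x75800bd4c610300, 0x7900c5d48610300, 0x8090bd547600031, 0xbc075948600031, 0x0, 0x908ca53726400d,
  0x8a0c6d597010304, 0x8a0c6d597204001, 0x9308da5270c6001, 0x8a0c3d240697001, 0x8a0c7d903254001,
  0x46085a0c9d23001, 0x5a0c7093d264001, 0x7a0c06d83254001, 0x7900c5d48623001, 0x9008da547623001,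
  0x1, 0x5, 0xa0c76980000004, 0x3087a9000c0006, 0xa0c73900080004, 0xa0c89030060004,
  0xa0c70930060004, 0xa0c07830060004, 0x900c7830060004, 0x87a940600003, 0xa0c75948600002,
  0xa0c76983050002, 0x4087a930c60002, 0xa0c75908340002, 0x6085a0c9340002, 0xa0c70943650002,
  0xa0c06587340002, 0x900c6587340002, 0x87a956340002, 0x1, 0x2, 0x6, 0xb0d87a900000005,
  0x4098ba000d00007, 0xb0d84a000900005, 0xb0d9a0400700005, 0xb0d80a400700005, 0xb0d089400700005,
  0xa00d89400700005, 0x98ba507000004, 0xb0d86a597000003, 0xb0d87a940600003, 0x5098ba40d700003,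
  0xb0d86a094500003, 0x7096b0da4500003, 0xb0d80a547600003, 0xb0d076984500003, 0xa00d76984500003,
  0x98ba674500003, 0xa09db6483750000, 0xa09db6587204000, 0xa09db3527086000, 0xa09db6480723000,
  0xa09db7803254000, 0xa09db6083254000, 0xa09db0547623000, 0xb0d706a83254000, 0x7090b6d83254000,
  0x9008da547623000, 0x97b6a83254000, 0x2, 0xa8c7b943650001, 0x3, 0xa9cb7856000004, 0x7,
  0xa9cb6080000005, 0xa8c0b000000096, 0xa9cb0000000058, 0xa5c0000b000096, 0xa8c0b000000056,
  0xbc005008000096, 0xa0c05008000096, 0x98ba000000056, 0xa8c7b900000064, 0xa8c7b900000054,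
  0xa9cb5008000064, 0x795b0c0a000064, 0xa7c06b80000054, 0xbc075908000064, 0xa0c75908000064,
  0x97b6a80000054, 0xa8c7b940600051, 0xa8c7b956000031, 0xa8c7b940600031, 0xa8c7b904500031,
  0xa9cb5048600031, 0x795b0c4a600031, 0xa7c06b84500031, 0xbc075948600031, 0xa0c75948600031,
  0x97b6a84500031]

/-- A strategy that forces 10 edges with different ends on a cycle of 16 vertices, cut open at a
vertex of the first player whose successor belongs to the second player, for `checkStrategy`. -/
def differentStrategy16 : List ℕ := [
  0xefcdab89674500003, 0x4, 0xefcdab89056000007, 0xefcdab89670000002, 0xefcdab89002005007, 0x8,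
  0xefcdab50009000006, 0xefcd69a00b0000002, 0xefcd09a000200500b, 0xefcdab00056000002,
  0xef5bc02000d009006, 0x6, 0xefcd005000900000a, 0xefcd09a0000000002, 0xef5a0c0000d000002,
  0xef50002000d00900c, 0xef20005000900d00a, 0xef0a0c50009000002, 0xa0cd0f50009000002,
  0xde2005000900c00a, 0xef20ab5000900d006, 0xef0bc9a0056000002, 0xcdab6009200500f, 0x6,
  0xdebc05000900000a, 0xdebc9a0000000002, 0xde5ab0000c000002, 0xde5002000c00900b,
  0xde2005000900c00a, 0xde0ab50009000002, 0xbc9a000200500e, 0xd, 0xbc05000900000a, 0xbc9a0000000002,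
  0x5ab0000c000002, 0x5002000c00900b, 0x2005000900c00a, 0xab50009000002, 0xefcdab20056009007,
  0xefcdab07856000002, 0xefcd008967200500b, 0xa, 0xefcd0089056000007, 0xefcd0089670000002,
  0xefcd0089002005007, 0x6, 0xefcd0050009000008, 0xefcd0089000000002, 0xef50002000d00900c,
  0xef58000c00d000002, 0xef20005000900d008, 0xef08005c009000002, 0x80cd005f009000002,
  0xde2005000900c008, 0xefcd0020056009007, 0xefcd0007856000002, 0xef20008905600d007,
  0xef070089c56000002, 0x70cd0089f56000002, 0xde2008905600c007, 0xef20ab8905600d007,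
  0xef0bc9a7856000002, 0xcdab8967200500f, 0xe, 0xcdab89056000007, 0xcdab89670000002,
  0xcdab89002005007, 0x6, 0xcdab50009000008, 0xcdab89000000002, 0x9, 0xcd050000a00000b,
  0xcdab00000000002, 0x5bc00000d000002, 0x50020000d00a00c, 0x20050000a00d00b, 0xbc50000a000002,
  0xcdab00002005008, 0x5bc08900d000002, 0x5009a200d00800c, 0x20ab5000900d008, 0xbc58900a000002,
  0xcdab20056009007, 0xcdab07856000002, 0xcd008967200500b, 0xa, 0xcd0089056000007,
  0xcd0089670000002, 0xcd0089002005007, 0x6, 0xcd0050009000008, 0xcd0089000000002,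
  0x50002000d00900c, 0x58000c00d000002, 0x20005000900d008, 0x8005c009000002, 0xcd0020056009007,
  0xcd0007856000002, 0x20008905600d007, 0x70089c56000002, 0x20ab8905600d007, 0xbc9a7856000002, 0x3,
  0xefcdab89670000005, 0x6, 0xefcdab89000000007, 0xefcdab20000009008, 0x9, 0xefcdab00000000007,
  0xefcd020000000a00b, 0xef2bc00000000d007, 0xef200700a0000d00c, 0xef700200d0000a00b,
  0xef0bc20000000a007, 0xcdab0020000700f, 0xe, 0xcdab00000000007, 0xcd020000000a00b,
  0x2bc00000000d007, 0x200700a0000d00c, 0x700200d0000a00b, 0xbc20000000a007, 0xefcdab00200007008,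
  0xef2bc00780000d009, 0xef2009a780000d00c, 0xb, 0xefa00d89000000007, 0xefa00d20000009008,
  0xef700200d0000a009, 0xefa00d00200007008, 0xef9000d0200007008, 0xef0009a0200007008,
  0xd0f009a0200007008, 0xde009a0200007008, 0xef0bc9a0200007008, 0xcdab8920000700f, 0xe,
  0xcdab89000000007, 0xcdab20000009008, 0x9, 0xcdab00000000007, 0xcd020000000a00b,
  0x2bc00000000d007, 0x200700a0000d00c, 0x700200d0000a00b, 0xbc20000000a007, 0xcdab00200007008,
  0x2bc00780000d009, 0x2009a780000d00c, 0xb, 0xa00d89000000007, 0xa00d20000009008,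
  0x700200d0000a009, 0xa00d00200007008, 0x9000d0200007008, 0x9a0200007008, 0xbc9a0200007008,
  0xefcdab27800009005, 0xefcdab20056009008, 0x9, 0xefcdab00670000005, 0xefcd020067000a00b,
  0xefcd7200b0000a005, 0xefcd020005600a00b, 0xefcd7000b20006005, 0xef200700a5600d00c,
  0xef700200d5600a00b, 0xef07ab00c20006005, 0x70cdab00f20006005, 0xe, 0xcdab00670000005,
  0xcd020067000a00b, 0xcd7200b0000a005, 0xcd020005600a00b, 0xcd7000b20006005, 0x200700a5600d00c,
  0x700200d5600a00b, 0x7ab00c20006005, 0xefcdab07820006005, 0xef2bc08967000d005,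
  0xef2009a785600d00c, 0x5, 0xefb0d9a7800000006, 0xefb0d9a2000008007, 0xef60ab200d0009008,
  0xefb0d9a0020006007, 0xef80ab0d020006007, 0xef9000d782000600b, 0xa, 0xef9000d7800000006,
  0xef9000d2000008007, 0xef6000200d0009008, 0xef9000d0020006007, 0xef80000d020006007,
  0xef000089020006007, 0xd0f00089020006007, 0xde00089020006007, 0xef00ab89020006007,
  0xd0f0ab89020006007, 0xde0ab89020006007, 0xef0bc9a7820006005, 0xcdab8925600700f, 0x5,
  0xdebc9a7800000006, 0xdebc9a2000008007, 0x8, 0xdebc9a0000000006, 0xdebc02000000900a,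
  0xde2ab0000000c006, 0xde2006009000c00b, 0xde600200c000900a, 0xde0ab20000009006, 0xbc9a002000600e,
  0xd, 0xbc9a0000000006, 0xbc02000000900a, 0x2ab0000000c006, 0x2006009000c00b, 0x600200c000900a,
  0xab20000009006, 0xdebc9a0020006007, 0xde2ab0067000c008, 0xde2008967000c00b, 0xa,
  0xde900c7800000006, 0xde900c2000008007, 0xde600200c0009008, 0xde900c0020006007,
  0xde8000c020006007, 0xde00089020006007, 0xc0e0089020006007, 0xcd0089020006007, 0xde0ab89020006007,
  0xbc9a782000600e, 0xd, 0xbc9a7800000006, 0xbc9a2000008007, 0x8, 0xbc9a0000000006,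
  0xbc02000000900a, 0x2ab0000000c006, 0x2006009000c00b, 0x600200c000900a, 0xab20000009006,
  0xbc9a0020006007, 0x2ab0067000c008, 0x2008967000c00b, 0xa, 0x900c7800000006, 0x900c2000008007,
  0x600200c0009008, 0x900c0020006007, 0x8000c020006007, 0x89020006007, 0xab89020006007,
  0xefcdab89670023004, 0xefcdab89004523007, 0x8, 0xefcd69a00b4500003, 0xefcd09a005620400b,
  0xefcdab20056009003, 0xefcd69a00b0023004, 0xefcd09a000452300b, 0xefcdab00056340002,
  0xefcd006009452300b, 0xc, 0xef9006d00a4500003, 0xef9000d005620400a, 0xade00f20056009003,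
  0xef9006d00a0023004, 0xef9000d000452300a, 0xade00f00056340002, 0xde0006009452300f,
  0xef0009a0056340002, 0xa00d6009452300f, 0xa, 0x69000d00e4500003, 0x9000d005620400e,
  0xde00020056009003, 0x69000d00e0023004, 0x9000d000452300e, 0xde00000056340002, 0x60000200e4509003,
  0x6, 0x9000d0004500003, 0x20005000900d004, 0x50002000d009003, 0x400020000d09003,
  0x50000000d340002, 0x20004509003, 0xef6009a00d452300b, 0xef0bc9a0056340002, 0xcdab6009452300f,
  0xe, 0xcd69a00b4500003, 0xcd09a005620400b, 0xcdab20056009003, 0xcd69a00b0023004,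
  0xcd09a000452300b, 0xcdab00056340002, 0xcd006009452300b, 0xa, 0x9600d00c4500003,
  0x9000d005620400c, 0xcd0020056009003, 0x9600d00c0023004, 0x9000d000452300c, 0xcd0000056340002,
  0x6, 0x9000d0004500003, 0x20005000900d004, 0x50002000d009003, 0x400020000d09003,
  0x50000000d340002, 0x20004509003, 0x600200c4509003, 0x6009a00d452300b, 0xbc9a0056340002, 0x7,
  0xefcdab60094500003, 0xefcdab20056009004, 0x3, 0xefcdab60090000005, 0x9, 0xefcdab00000000006,
  0xefcd020000000a00b, 0xef2bc00000000d006, 0xef2006000a000d00c, 0xef6002000d000a00b,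
  0xef0bc20000000a006, 0xcdab0002000600f, 0xe, 0xcdab00000000006, 0xcd020000000a00b,
  0x2bc00000000d006, 0x2006000a000d00c, 0x6002000d000a00b, 0xbc20000000a006, 0xefcdab20000009005,
  0xefcdab00020006005, 0xefcd90b0020006005, 0xefcd09a0020006005, 0xefb0d9a0020006005,
  0xef0bc9a0020006005, 0xd0fbc9a0020006005, 0xdebc9a0020006005, 0xefcdab60090023004,
  0xefcdab50009023004, 0xefcdab00056023004, 0xefcd90b0056023004, 0xefcd09a0056023004,
  0xefb0d9a0056023004, 0xef0bc9a0056023004, 0xd0fbc9a0056023004, 0xdebc9a0056023004,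
  0xefcdab07856023004, 0xefcd008967452300b, 0xc, 0xade00f89674500003, 0xde009a785620400f,
  0xef2009a785600d003, 0xade00f89670023004, 0xade00f89004523007, 0xde009a608452300f,
  0xef2009a067450d003, 0xade00f07856023004, 0xde0008967452300f, 0xef0009a7856340002,
  0xa00d8967452300f, 0xe, 0x8009ad674500003, 0x4, 0x5009a780d000006, 0x8009ad670000002,
  0x8009ad002005007, 0x5009a200d008006, 0x5009a067d000002, 0x6000078d200500a, 0x9,
  0x50000780d000006, 0x80000d670000002, 0x80000d002005007, 0x50000200d008006, 0x50000067d000002,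
  0x7856000002, 0x9a7856000002, 0x2009a785600d003, 0x8009ad670023004, 0x8009ad004523007, 0x6,
  0xa00d89004500003, 0x5009a200d008004, 0x2009a500800d003, 0x2009a400080d003, 0x2009a000450d003,
  0x20080a00450d003, 0x20008900450d003, 0x9a5008340002, 0x2009a067450d003, 0x6000078d452300a, 0x9,
  0x80000d674500003, 0x4, 0x50000780d000006, 0x80000d670000002, 0x80000d002005007,
  0x50000200d008006, 0x50000067d000002, 0x7856000002, 0x20000785600d003, 0x80000d670023004,
  0x80000d004523007, 0x6, 0x80000d004500003, 0x50000200d008004, 0x20000500800d003,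
  0x20000400080d003, 0x20000000450d003, 0x5008340002, 0x20000067450d003, 0x7856340002,
  0x9a7856340002, 0xb, 0xefa00d89674500003, 0xef2009a785600d004, 0x3, 0xefa00d89670000005, 0x6,
  0xefa00d89000000007, 0xefa00d20000009008, 0xef700200d0000a009, 0xefa00d00200007008,
  0xef9000d0200007008, 0xef0009a0200007008, 0xd0f009a0200007008, 0xde009a0200007008,
  0xefa00d27800009005, 0xef6002890d000a005, 0xef700200d5600a009, 0xefa00d07820006005,
  0xef9000d7820006005, 0xef0009a7820006005, 0xd0f009a7820006005, 0xde009a7820006005,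
  0xefa00d89670023004, 0xef5009a780d023004, 0xef6009a00d4523008, 0x7, 0xefa00d60094500003,
  0xefa00d20056009004, 0x3, 0xefa00d60090000005, 0xef6002000d000a009, 0xefa00d20000009005,
  0xefa00d00020006005, 0xef9000d0020006005, 0xef0009a0020006005, 0xd0f009a0020006005,
  0xde009a0020006005, 0xefa00d60090023004, 0xefa00d50009023004, 0xefa00d00056023004,
  0xef9000d0056023004, 0xef0009a0056023004, 0xd0f009a0056023004, 0xde009a0056023004,
  0xefa00d07856023004, 0xef9000d7856023004, 0xef0009a7856023004, 0xd0f009a7856023004,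
  0xde009a7856023004, 0xef0bc9a7856023004, 0xcdab8967452300f, 0xe, 0xcdab89674500003, 0x4,
  0xcdab89056000007, 0xcdab89670000002, 0xcdab89002005007, 0x6, 0xcdab50009000008,
  0xcdab89000000002, 0x9, 0xcd050000a00000b, 0xcdab00000000002, 0x5bc00000d000002,
  0x50020000d00a00c, 0x20050000a00d00b, 0xbc50000a000002, 0xcdab00002005008, 0x5bc08900d000002,
  0x5009a200d00800c, 0x20ab5000900d008, 0xbc58900a000002, 0xcdab20056009007, 0xcdab07856000002,
  0xcd008967200500b, 0xa, 0xcd0089056000007, 0xcd0089670000002, 0xcd0089002005007, 0x6,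
  0xcd0050009000008, 0xcd0089000000002, 0x50002000d00900c, 0x58000c00d000002, 0x20005000900d008,
  0x8005c009000002, 0xcd0020056009007, 0xcd0007856000002, 0x20008905600d007, 0x70089c56000002,
  0x20ab8905600d007, 0xbc9a7856000002, 0x3, 0xcdab89670000005, 0x6, 0xcdab89000000007,
  0xcdab20000009008, 0x9, 0xcdab00000000007, 0xcd020000000a00b, 0x2bc00000000d007,
  0x200700a0000d00c, 0x700200d0000a00b, 0xbc20000000a007, 0xcdab00200007008, 0x2bc00780000d009,
  0x2009a780000d00c, 0xb, 0xa00d89000000007, 0xa00d20000009008, 0x700200d0000a009,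
  0xa00d00200007008, 0x9000d0200007008, 0x9a0200007008, 0xbc9a0200007008, 0xcdab27800009005,
  0xcdab20056009008, 0x9, 0xcdab00670000005, 0xcd020067000a00b, 0xcd7200b0000a005,
  0xcd020005600a00b, 0xcd7000b20006005, 0x200700a5600d00c, 0x700200d5600a00b, 0x7ab00c20006005,
  0xcdab07820006005, 0x2bc08967000d005, 0x2009a785600d00c, 0x5, 0xb0d9a7800000006,
  0xb0d9a2000008007, 0x60ab200d0009008, 0xb0d9a0020006007, 0x80ab0d020006007, 0x9000d782000600b,
  0xa, 0x9000d7800000006, 0x9000d2000008007, 0x6000200d0009008, 0x9000d0020006007,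
  0x80000d020006007, 0x89020006007, 0xab89020006007, 0xbc9a7820006005, 0xcdab89670023004,
  0xcdab89004523007, 0x8, 0xcd69a00b4500003, 0xcd09a005620400b, 0xcdab20056009003,
  0xcd69a00b0023004, 0xcd09a000452300b, 0xcdab00056340002, 0xcd006009452300b, 0xa,
  0x9600d00c4500003, 0x9000d005620400c, 0xcd0020056009003, 0x9600d00c0023004, 0x9000d000452300c,
  0xcd0000056340002, 0x6, 0x9000d0004500003, 0x20005000900d004, 0x50002000d009003,
  0x400020000d09003, 0x50000000d340002, 0x20004509003, 0x600200c4509003, 0x6009a00d452300b,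
  0xbc9a0056340002, 0x7, 0xcdab60094500003, 0xcdab20056009004, 0x3, 0xcdab60090000005, 0x9,
  0xcdab00000000006, 0xcd020000000a00b, 0x2bc00000000d006, 0x2006000a000d00c, 0x6002000d000a00b,
  0xbc20000000a006, 0xcdab20000009005, 0xcdab00020006005, 0xcd90b0020006005, 0xcd09a0020006005,
  0xb0d9a0020006005, 0xbc9a0020006005, 0xcdab60090023004, 0xcdab50009023004, 0xcdab00056023004,
  0xcd90b0056023004, 0xcd09a0056023004, 0xb0d9a0056023004, 0xbc9a0056023004, 0xcdab07856023004,
  0xcd008967452300b, 0xc, 0x8009ad674500003, 0x4, 0x5009a780d000006, 0x8009ad670000002,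
  0x8009ad002005007, 0x5009a200d008006, 0x5009a067d000002, 0x6000078d200500a, 0x9,
  0x50000780d000006, 0x80000d670000002, 0x80000d002005007, 0x50000200d008006, 0x50000067d000002,
  0x7856000002, 0x9a7856000002, 0x2009a785600d003, 0x8009ad670023004, 0x8009ad004523007, 0x6,
  0xa00d89004500003, 0x5009a200d008004, 0x2009a500800d003, 0x2009a400080d003, 0x2009a000450d003,
  0x20080a00450d003, 0x20008900450d003, 0x9a5008340002, 0x2009a067450d003, 0x6000078d452300a, 0x9,
  0x80000d674500003, 0x4, 0x50000780d000006, 0x80000d670000002, 0x80000d002005007,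
  0x50000200d008006, 0x50000067d000002, 0x7856000002, 0x20000785600d003, 0x80000d670023004,
  0x80000d004523007, 0x6, 0x80000d004500003, 0x50000200d008004, 0x20000500800d003,
  0x20000400080d003, 0x20000000450d003, 0x5008340002, 0x20000067450d003, 0x7856340002,
  0x9a7856340002, 0xb, 0xa00d89674500003, 0x2009a785600d004, 0x3, 0xa00d89670000005, 0x6,
  0xa00d89000000007, 0xa00d20000009008, 0x700200d0000a009, 0xa00d00200007008, 0x9000d0200007008,
  0x9a0200007008, 0xa00d27800009005, 0x6002890d000a005, 0x700200d5600a009, 0xa00d07820006005,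
  0x9000d7820006005, 0x9a7820006005, 0xa00d89670023004, 0x5009a780d023004, 0x6009a00d4523008, 0x7,
  0xa00d60094500003, 0xa00d20056009004, 0x3, 0xa00d60090000005, 0x6002000d000a009,
  0xa00d20000009005, 0xa00d00020006005, 0x9000d0020006005, 0x9a0020006005, 0xa00d60090023004,
  0xa00d50009023004, 0xa00d00056023004, 0x9000d0056023004, 0x9a0056023004, 0xa00d07856023004,
  0x9000d7856023004, 0x9a7856023004, 0xbc9a7856023004]

theorem forces_equal_sixteen :
    Forces (fun M => 6 ≤ cnt true M) (List.replicate 16 none) :=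
  forces_of_checkStrategy 8 _ equalStrategy16 (by decide +kernel)

theorem forces_equal_fourteen :
    Forces (fun M => 5 ≤ cnt true M) (List.replicate 14 none) :=
  forces_of_checkStrategy 7 _ equalStrategy14 (by decide +kernel)

/-- The last entry repeats the first, so the consecutive pairs are the 16 edges of the cycle. Being
labelled, index 16 is never a reply or a partner, so one hexadecimal digit suffices. -/
theorem forces_different_seventeen : Forces (fun M => 10 ≤ cnt false M)
    (some false :: some true :: (List.replicate 14 none ++ [some false])) :=
  forces_of_checkStrategy 7 _ differentStrategy16 (by decide +kernel)

/-! ### From the cycle to the path on 16 vertices. -/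

/-- Moving the last entry of a list to its front. -/
theorem Forces.rotate {P Q : List Bool → Prop} (h : ∀ a M, P (M ++ [a]) → Q (a :: M))
    {a : Option Bool} {L : List (Option Bool)} (hL : Forces P (L ++ [a])) : Forces Q (a :: L) := by
  generalize hK : L ++ [a] = K at hL
  induction hL generalizing a L with
  | intro K r h1 h2 h3 ih =>
    subst hK
    -- Moves and replies are carried over by the cyclic shift of indices: `j` becomes `j + 1`, and
    -- the last index becomes `0`.
    have key : ∀ i, (L ++ [a])[i]? = some none →
        ∃ j, ((a :: L).set (if i < L.length then i + 1 else 0) (some false))[j]? = some none ∧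
          Forces Q (((a :: L).set (if i < L.length then i + 1 else 0) (some false)).set j
            (some true)) := by
      have hset : ∀ (L : List (Option Bool)) (a x : Option Bool) (j : ℕ), j < L.length + 1 →
          ∃ L' a', (L ++ [a]).set j x = L' ++ [a'] ∧ L'.length = L.length ∧
            (a :: L).set (if j < L.length then j + 1 else 0) x = a' :: L' := by
        intro L a x j hj
        by_cases hjL : j < L.length
        · exact ⟨L.set j x, a, by rw [List.set_append_left _ _ hjL], by simp, by simp [hjL]⟩
        · obtain rfl : j = L.length := by omega
          exact ⟨L, x, by simp, rfl, by simp⟩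
      intro i hi
      have hil := (List.getElem?_eq_some_iff.1 hi).1
      have hr := h1 i hi
      have hrl := (List.getElem?_eq_some_iff.1 hr).1
      have hi' := fun K b => @ih i hi K b
      simp only [List.length_append, List.length_cons, List.length_nil, List.length_set,
        Nat.zero_add] at hil hrl
      obtain ⟨L₁, a₁, e1, hl1, e1'⟩ := hset L a (some false) i hil
      rw [e1] at hr hi'
      obtain ⟨L₂, a₂, e2, hl2, e2'⟩ := hset L₁ a₁ (some true) (r i) (by omega)
      refine ⟨if r i < L₁.length then r i + 1 else 0, ?_, ?_⟩
      · rw [e1']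
        split_ifs with hlt
        · rw [List.getElem?_append_left hlt] at hr
          simpa using hr
        · obtain e : r i = L₁.length := by omega
          rw [e] at hr
          simpa using hr
      · rw [e1', e2']
        exact hi' _ _ e2.symm
    refine .of_exists (fun i hi => ?_) fun M hM => ?_
    · cases i with
      | zero => simpa using key L.length (by simpa using hi)
      | succ i =>
        rw [List.getElem?_cons_succ] at hi
        have hil := (List.getElem?_eq_some_iff.1 hi).1
        simpa [hil] using key i (by rw [List.getElem?_append_left hil, hi])
    · obtain ⟨b, M, rfl, rfl, rfl⟩ := List.map_eq_cons_iff.1 hM.symm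
      exact h b M (h3 _ (by simp))

theorem Forces.of_concat {P : List Bool → Prop} {b : Bool} {L : List (Option Bool)}
    (hL : Forces P (L ++ [some b])) : Forces (fun M => P (M ++ [b])) L := by
  generalize hK : L ++ [some b] = K at hL
  induction hL generalizing L with
  | intro K r h1 h2 h3 ih =>
    subst hK
    refine .of_exists (fun i hi => ?_) fun M hM => h3 _ (by simp [hM])
    have hil := (List.getElem?_eq_some_iff.1 hi).1
    have hi' : (L ++ [some b])[i]? = some none := by rw [List.getElem?_append_left hil, hi]
    have hr := h1 i hi'
    have hs := fun K => @ih i hi' K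
    rw [List.set_append_left _ _ hil] at hr hs
    have hrl : r i < (L.set i (some false)).length := by
      by_contra hge
      rw [List.getElem?_append_right (by omega), List.getElem?_singleton] at hr
      split_ifs at hr
      simp at hr
    rw [List.getElem?_append_left hrl] at hr
    exact ⟨r i, hr, hs _ (by rw [List.set_append_left _ _ hrl])⟩

/-- Labels are never changed in play. This identifies the head of the final list, which `cyclicCnt`
needs. -/
theorem Forces.and_agree {P : List Bool → Prop} {L : List (Option Bool)} (hL : Forces P L) :
    Forces (fun M => P M ∧ ∀ (i : ℕ) (b : Bool), L[i]? = some (some b) → M[i]? = some b) L := by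
  induction hL with
  | intro L r h1 h2 h3 ih =>
    refine .intro L r h1 (fun i hi => (ih i hi).mono fun M hM => ⟨hM.1, fun k b hk => hM.2 k b ?_⟩)
      fun M hM => ⟨h3 M hM, fun i b h => by simpa [hM] using h⟩
    have h1' := h1 i hi
    grind

theorem cnt_concat_concat (s : Bool) (M : List Bool) (a b : Bool) :
    cnt s (M ++ [a, b]) = cnt s (M ++ [a]) + if (a == b) = s then 1 else 0 := by
  induction M with
  | nil => simp [cnt]
  | cons c M ih => cases M <;> (simp_all [cnt]; try omega)

/-- The number of pairs of cyclically consecutive entries that are different. -/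
def cyclicCnt (M : List Bool) : ℕ := cnt false (M ++ M.head?.toList)

theorem cyclicCnt_cons (a : Bool) (M : List Bool) : cyclicCnt (a :: M) = cyclicCnt (M ++ [a]) := by
  cases M with
  | nil => rfl
  | cons b M =>
    have := cnt_concat_concat false (b :: M) a b
    simp only [cyclicCnt, List.cons_append, List.head?_cons, Option.toList_some, cnt,
      List.append_assoc, List.nil_append] at this ⊢
    rw [this, add_comm, beq_eq_beq.2 eq_comm]

/-- Opening the cycle loses only the closing pair. -/
theorem cyclicCnt_le (M : List Bool) : cyclicCnt M ≤ cnt false M + 1 := by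
  rcases List.eq_nil_or_concat M with rfl | ⟨M, a, rfl⟩
  · simp [cyclicCnt]
  · have key (o : Option Bool) : cnt false (M ++ [a] ++ o.toList) ≤ cnt false (M ++ [a]) + 1 := by
      cases o with
      | none => simp
      | some b =>
        have := cnt_concat_concat false M a b
        rw [Option.toList_some, List.append_assoc, List.cons_append, List.nil_append, this]
        split_ifs <;> omega
    rw [List.concat_eq_append]
    exact key (M ++ [a]).head?

theorem forces_different_zero : Forces (fun M => 10 ≤ cyclicCnt M)
    (some false :: some true :: List.replicate 14 none) := by
  refine (Forces.of_concat (b := false) (L := some false :: some true :: List.replicate 14 none)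
    forces_different_seventeen).and_agree.mono fun M hM => ?_
  have := hM.2 0 false rfl
  rw [← List.head?_eq_getElem?] at this
  simpa [cyclicCnt, this] using hM.1

theorem forces_different_shift (k l : ℕ) (h : k + l = 14) : Forces (fun M => 10 ≤ cyclicCnt M)
    (List.replicate k none ++ some false :: some true :: List.replicate l none) := by
  induction k generalizing l with
  | zero => obtain rfl : l = 14 := by omega
            exact forces_different_zero
  | succ k ih =>
    refine Forces.rotate (P := fun M => 10 ≤ cyclicCnt M) (Q := fun M => 10 ≤ cyclicCnt M)
      (fun a M hM => (cyclicCnt_cons a M).symm ▸ hM)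
      (L := List.replicate k none ++ some false :: some true :: List.replicate l none) ?_
    simpa [List.replicate_succ'] using ih (l + 1) (by omega)

/-- On the cycle the second player answers the opening move at its cyclic successor. All positions
so reached are rotations of a single one, where 10 different pairs can be forced; opening the cycle
costs at most one. -/
theorem forces_different_sixteen :
    Forces (fun M => 9 ≤ cnt false M) (List.replicate 16 none) := by
  suffices h : Forces (fun M => 10 ≤ cyclicCnt M) (List.replicate 16 none) from
    h.mono fun M hM => by have := cyclicCnt_le M; omega
  refine .of_exists (fun i hi => ?_) fun M hM => ?_
  · have hil : i < 16 := by simpa using (List.getElem?_eq_some_iff.1 hi).1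
    rcases eq_or_ne i 15 with rfl | hne
    · refine ⟨0, rfl, ?_⟩
      change Forces _ (some true :: (List.replicate 14 none ++ [some false]))
      refine Forces.rotate (P := fun M => 10 ≤ cyclicCnt M) (Q := fun M => 10 ≤ cyclicCnt M)
        (fun a M hM => (cyclicCnt_cons a M).symm ▸ hM) ?_
      simpa using forces_different_shift 14 0 rfl
    · have := forces_different_shift i (14 - i) (by omega)
      refine ⟨i + 1, ?_, ?_⟩
      · interval_cases i <;> first | rfl | exact absurd rfl hne
      · convert this using 1
        interval_cases i <;> first | rfl | exact absurd rfl hne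
  · have := congrArg List.head? hM
    cases M <;> simp [List.replicate] at this

theorem forces_different_two : Forces (fun M => 1 ≤ cnt false M) [none, none] :=
  forces_of_pairingBound (f := fun i => 1 - i) (by decide) (by decide)

/-! ### Forcing on lists of any even length. -/

theorem forces_different_replicate (q k : ℕ) :
    Forces (fun M => 9 * q + k ≤ cnt false M) (List.replicate (16 * q + 2 * k) none) := by
  induction q with
  | zero =>
    induction k with
    | zero => exact .of_exists (by simp) (by simp)
    | succ k ih =>
      have := ih.cnt_append forces_different_two
      rwa [show [none, none] = List.replicate 2 (none : Option Bool) from rfl,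
        List.replicate_append_replicate] at this
  | succ q ih =>
    have := forces_different_sixteen.cnt_append ih
    rw [List.replicate_append_replicate] at this
    convert this using 2 <;> ring_nf

/-- The bound is the one that keeps `r - 1 - 2 * t` at most 3. By truncated subtraction it asks for
nothing when `r ≤ 4`; fixed pairings serve up to 12, and a strategy tree serves 14. -/
theorem forces_equal_small {r : ℕ} (hr : r < 16) (he : Even r) :
    Forces (fun M => (r - 4) / 2 ≤ cnt true M) (List.replicate r none) := by
  have pairing (n c : ℕ) (h : isPairing (hexDigit c) (List.replicate n none) = true)
      (h' : pairingBound true (hexDigit c) (List.replicate n (none : Option Bool)).length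
        (List.replicate n (none : Option Bool)).length none ((n - 4) / 2) (List.replicate n none) =
          true) : Forces (fun M => (n - 4) / 2 ≤ cnt true M) (List.replicate n none) :=
    forces_of_pairingBound h h'
  obtain rfl | rfl | rfl | rfl | rfl | rfl | rfl | rfl : r = 0 ∨ r = 2 ∨ r = 4 ∨ r = 6 ∨ r = 8 ∨
      r = 10 ∨ r = 12 ∨ r = 14 := by
    obtain ⟨k, rfl⟩ := he
    omega
  · exact pairing 0 0 (by decide) (by decide)
  · exact pairing 2 0x01 (by decide) (by decide)
  -- Digit `i` of the code, counted from the right, is the partner of entry `i`.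
  · exact pairing 4 0x2301 (by decide) (by decide)
  · exact pairing 6 0x325401 (by decide +kernel) (by decide +kernel)
  · exact pairing 8 0x53726401 (by decide +kernel) (by decide +kernel)
  · exact pairing 10 0x7594861032 (by decide +kernel) (by decide +kernel)
  · exact pairing 12 0x97b6a8315042 (by decide +kernel) (by decide +kernel)
  · exact forces_equal_fourteen

theorem forces_equal_replicate (q : ℕ) {r : ℕ} (hr : r < 16) (he : Even r) :
    Forces (fun M => 6 * q + (r - 4) / 2 ≤ cnt true M) (List.replicate (16 * q + r) none) := by
  induction q with
  | zero => simpa using forces_equal_small hr he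
  | succ q ih =>
    have := forces_equal_sixteen.cnt_append ih
    rw [List.replicate_append_replicate] at this
    convert this using 2 <;> ring_nf

/-! ### The value of the game and the advantage of moving. -/

section

variable {V : Type*} [Fintype V] [DecidableEq V] (G : SimpleGraph V) [DecidableRel G.Adj]

theorem value_eq_score (p : Player) {S₀ S₁ : Finset V} (h : (S₀ ∪ S₁)ᶜ = ∅) :
    value G p S₀ S₁ = score G S₀ S₁ := by
  rw [value, dif_neg (by simp [h])]

theorem value_admirable_le {S₀ S₁ : Finset V} {v : V} (hv : v ∉ S₀ ∪ S₁) :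
    value G .admirable S₀ S₁ ≤ value G .impish (insert v S₀) S₁ := by
  have hv' := Finset.mem_compl.2 hv
  rw [value, dif_pos ⟨v, hv'⟩]
  exact Finset.inf'_le (fun v : {v // v ∈ (S₀ ∪ S₁)ᶜ} => value G .impish (insert v.1 S₀) S₁)
    (Finset.mem_attach _ ⟨v, hv'⟩)

theorem le_value_impish {S₀ S₁ : Finset V} {v : V} (hv : v ∉ S₀ ∪ S₁) :
    value G .admirable S₀ (insert v S₁) ≤ value G .impish S₀ S₁ := by
  have hv' := Finset.mem_compl.2 hv
  conv_rhs => rw [value, dif_pos ⟨v, hv'⟩]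
  exact Finset.le_sup' (fun v : {v // v ∈ (S₀ ∪ S₁)ᶜ} => value G .admirable S₀ (insert v.1 S₁))
    (Finset.mem_attach _ ⟨v, hv'⟩)

theorem exists_value_admirable_eq {S₀ S₁ : Finset V} (h : (S₀ ∪ S₁)ᶜ.Nonempty) :
    ∃ v ∉ S₀ ∪ S₁, value G .admirable S₀ S₁ = value G .impish (insert v S₀) S₁ := by
  obtain ⟨v, -, hv⟩ := Finset.exists_mem_eq_inf' (Finset.attach_nonempty_iff.2 h)
    (fun v : {v // v ∈ (S₀ ∪ S₁)ᶜ} => value G .impish (insert v.1 S₀) S₁)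
  exact ⟨v.1, Finset.mem_compl.1 v.2, by rw [value, dif_pos h]; exact hv⟩

theorem exists_value_impish_eq {S₀ S₁ : Finset V} (h : (S₀ ∪ S₁)ᶜ.Nonempty) :
    ∃ v ∉ S₀ ∪ S₁, value G .impish S₀ S₁ = value G .admirable S₀ (insert v S₁) := by
  obtain ⟨v, -, hv⟩ := Finset.exists_mem_eq_sup' (Finset.attach_nonempty_iff.2 h)
    (fun v : {v // v ∈ (S₀ ∪ S₁)ᶜ} => value G .admirable S₀ (insert v.1 S₁))
  exact ⟨v.1, Finset.mem_compl.1 v.2, by rw [value, dif_pos h]; exact hv⟩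

/-- If the number of unlabelled vertices is even, then an additional label of Admirable, and also
moving first, does no harm to Admirable. -/
theorem value_impish_insert_le (k : ℕ) : ∀ S₀ S₁ : Finset V, (S₀ ∪ S₁)ᶜ.card = 2 * k →
    value G .admirable S₀ S₁ ≤ value G .impish S₀ S₁ ∧
    ∀ x ∉ S₀ ∪ S₁, value G .impish (insert x S₀) S₁ ≤ value G .impish S₀ S₁ := by
  induction k with
  | zero =>
    intro S₀ S₁ h
    have h := Finset.card_eq_zero.1 h
    refine ⟨by rw [value_eq_score G _ h, value_eq_score G _ h], fun x hx => ?_⟩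
    have := Finset.mem_compl.2 hx
    simp [h] at this
  | succ k ih =>
    intro S₀ S₁ h
    have key : ∀ x ∉ S₀ ∪ S₁, value G .impish (insert x S₀) S₁ ≤ value G .impish S₀ S₁ := by
      intro x hx
      have hc : (insert x S₀ ∪ S₁)ᶜ.card + 1 = (S₀ ∪ S₁)ᶜ.card := by
        rw [Finset.insert_union, Finset.compl_insert,
          Finset.card_erase_add_one (Finset.mem_compl.2 hx)]
      obtain ⟨v, hv, e⟩ := exists_value_impish_eq G (S₀ := insert x S₀) (S₁ := S₁)
        (Finset.card_pos.1 (by omega))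
      rw [e]
      have hvx : v ≠ x := by rintro rfl; simp at hv
      have hv' : v ∉ S₀ ∪ S₁ := by simp at hv ⊢; tauto
      have hc1 : (S₀ ∪ insert v S₁)ᶜ.card + 1 = (S₀ ∪ S₁)ᶜ.card := by
        rw [Finset.union_insert, Finset.compl_insert,
          Finset.card_erase_add_one (Finset.mem_compl.2 hv')]
      -- Impish's best move `v` against the extra label `x` is also legal without it. Compare the
      -- two games after `v`, where `w` will be Admirable's best answer in the game without `x`.
      refine le_trans ?_ (le_value_impish G hv')
      obtain ⟨w, hw, e'⟩ := exists_value_admirable_eq G (S₀ := S₀) (S₁ := insert v S₁)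
        (Finset.card_pos.1 (by omega))
      rw [e']
      have hc2 : (insert w S₀ ∪ insert v S₁)ᶜ.card + 1 = (S₀ ∪ insert v S₁)ᶜ.card := by
        rw [Finset.insert_union, Finset.compl_insert,
          Finset.card_erase_add_one (Finset.mem_compl.2 hw)]
      obtain ⟨h1, h2⟩ := ih (insert w S₀) (insert v S₁) (by omega)
      -- If `w = x`, the positions differ only in who moves, which is the first half of the
      -- induction hypothesis. Otherwise Admirable plays `w` in both games, and `x` is again an
      -- extra label.
      rcases eq_or_ne w x with rfl | hwx
      · exact h1
      · have hw' : w ∉ insert x S₀ ∪ insert v S₁ := by simp at hw ⊢; tauto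
        refine (value_admirable_le G hw').trans ?_
        rw [Finset.insert_comm]
        refine h2 x ?_
        simp at hx ⊢
        tauto
    refine ⟨?_, key⟩
    obtain ⟨x, hx⟩ := Finset.card_pos.1 (show 0 < (S₀ ∪ S₁)ᶜ.card by omega)
    have hx := Finset.mem_compl.1 hx
    -- A move by Admirable is an extra label followed by Impish's turn. The final scoring rule plays
    -- no role in this argument.
    exact (value_admirable_le G hx).trans (key x hx)

theorem value_admirable_le_value_impish {S₀ S₁ : Finset V} (h : Even (S₀ ∪ S₁)ᶜ.card) :
    value G .admirable S₀ S₁ ≤ value G .impish S₀ S₁ := by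
  obtain ⟨k, hk⟩ := h
  exact (value_impish_insert_le G k S₀ S₁ (by omega)).1

end

/-! ### Labelled paths as lists. -/

/-- The labels of the vertices of a path, where the vertices in `A` belong to the first player and
those in `D` to the second player. -/
def labels {n : ℕ} (A D : Finset (Fin n)) : List (Option Bool) :=
  List.ofFn fun v => if v ∈ D then some true else if v ∈ A then some false else none

theorem labels_getElem?_eq_none {n : ℕ} {A D : Finset (Fin n)} {i : ℕ} :
    (labels A D)[i]? = some none ↔ ∃ v : Fin n, v.1 = i ∧ v ∉ A ∧ v ∉ D := by
  simp only [labels, List.getElem?_ofFn]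
  constructor
  · intro h
    by_cases h1 : i < n
    swap
    · simp [h1] at h
    rw [dif_pos h1] at h
    refine ⟨⟨i, h1⟩, rfl, ?_⟩
    by_cases h2 : (⟨i, h1⟩ : Fin n) ∈ D
    · simp [h2] at h
    by_cases h3 : (⟨i, h1⟩ : Fin n) ∈ A
    · simp [h2, h3] at h
    exact ⟨h3, h2⟩
  · rintro ⟨v, rfl, h1, h2⟩
    simp [h1, h2]

theorem labels_set_false {n : ℕ} {A D : Finset (Fin n)} {v : Fin n} (hv : v ∉ D) :
    (labels A D).set v (some false) = labels (insert v A) D := by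
  apply List.ext_getElem?
  intro i
  simp only [labels, List.getElem?_set, List.getElem?_ofFn, List.length_ofFn]
  by_cases h : v.1 = i
  · subst h; simp [hv]
  · by_cases hi : i < n
    · have : (⟨i, hi⟩ : Fin n) ≠ v := by rintro rfl; exact h rfl
      simp [h, hi, this]
    · simp [h, hi]

theorem labels_set_true {n : ℕ} {A D : Finset (Fin n)} {v : Fin n} :
    (labels A D).set v (some true) = labels A (insert v D) := by
  apply List.ext_getElem?
  intro i
  simp only [labels, List.getElem?_set, List.getElem?_ofFn, List.length_ofFn]
  by_cases h : v.1 = i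
  · subst h; simp
  · by_cases hi : i < n
    · have : (⟨i, hi⟩ : Fin n) ≠ v := by rintro rfl; exact h rfl
      simp [h, hi, this]
    · simp [h, hi]

theorem labels_of_union_eq_univ {n : ℕ} {A D : Finset (Fin n)} (h : A ∪ D = Finset.univ) :
    labels A D = (List.ofFn fun v => decide (v ∈ D)).map some := by
  rw [labels, List.map_ofFn]
  congr 1
  funext v
  have : v ∈ A ∪ D := h ▸ Finset.mem_univ v
  by_cases hv : v ∈ D
  · simp [hv]
  · simp [hv, (Finset.mem_union.1 this).resolve_right hv]

theorem cnt_ofFn (s : Bool) {n : ℕ} (l : Fin (n + 1) → Bool) :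
    cnt s (List.ofFn l) =
      (Finset.univ.filter fun i : Fin n => (l i.castSucc == l i.succ) = s).card := by
  induction n with
  | zero => simp [cnt]
  | succ n ih =>
    rw [Fin.card_filter_univ_succ, List.ofFn_succ, List.ofFn_succ, cnt,
      ← List.ofFn_succ (f := fun i => l i.succ), ih]
    simp only [Fin.castSucc_zero, Fin.succ_zero_eq_one, Fin.succ_castSucc]
    by_cases h : (l 0 == l 1) = s <;> simp only [h, if_true, if_false] <;> omega

theorem cnt_add_cnt {n : ℕ} (l : Fin (n + 1) → Bool) :
    cnt false (List.ofFn l) + cnt true (List.ofFn l) = n := by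
  rw [cnt_ofFn, cnt_ofFn, add_comm]
  have := Finset.card_filter_add_card_filter_not (s := (Finset.univ : Finset (Fin n)))
    fun i => (l i.castSucc == l i.succ) = true
  simpa using this

theorem card_filter_edgeFinset_pathGraph {n : ℕ} [DecidableRel (SimpleGraph.pathGraph (n + 1)).Adj]
    (p : Sym2 (Fin (n + 1)) → Prop) [DecidablePred p] :
    ((SimpleGraph.pathGraph (n + 1)).edgeFinset.filter p).card =
      (Finset.univ.filter fun i : Fin n => p s(i.castSucc, i.succ)).card := by
  symm
  refine Finset.card_bij (fun i _ => s(i.castSucc, i.succ)) ?_ ?_ ?_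
  · intro i hi
    simpa [SimpleGraph.pathGraph_adj] using hi
  · intro i _ j _ h
    simp only [Sym2.eq_iff, Fin.ext_iff, Fin.val_castSucc, Fin.val_succ] at h ⊢
    omega
  · intro e he
    induction e with
    | _ u v =>
      simp only [Finset.mem_filter, SimpleGraph.mem_edgeFinset, SimpleGraph.mem_edgeSet,
        SimpleGraph.pathGraph_adj] at he
      obtain ⟨h | h, hp⟩ := he
      · have e : s(u, v) = s((⟨u, by omega⟩ : Fin n).castSucc, (⟨u, by omega⟩ : Fin n).succ) := by
          simp [h]
        exact ⟨⟨u, by omega⟩, by rw [Finset.mem_filter, ← e]; exact ⟨Finset.mem_univ _, hp⟩, e.symm⟩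
      · have e : s(u, v) = s((⟨v, by omega⟩ : Fin n).castSucc, (⟨v, by omega⟩ : Fin n).succ) := by
          rw [Sym2.eq_swap]
          simp [h]
        exact ⟨⟨v, by omega⟩, by rw [Finset.mem_filter, ← e]; exact ⟨Finset.mem_univ _, hp⟩, e.symm⟩

/-- Exchanging the two labels preserves equality and difference of neighbours, so `true` may mark
whichever player moves second. -/
theorem score_pathGraph {n : ℕ} [DecidableRel (SimpleGraph.pathGraph (n + 1)).Adj]
    {S₀ S₁ D : Finset (Fin (n + 1))} (h : S₀ ∪ S₁ = Finset.univ) (hd : Disjoint S₀ S₁)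
    (hD : D = S₀ ∨ D = S₁) : score (SimpleGraph.pathGraph (n + 1)) S₀ S₁ =
      (cnt false (List.ofFn fun v => decide (v ∈ D)) : ℤ) -
        cnt true (List.ofFn fun v => decide (v ∈ D)) := by
  have hm (v : Fin (n + 1)) : v ∈ S₁ ↔ v ∉ S₀ := by
    have h1 : v ∈ S₀ ∪ S₁ := h ▸ Finset.mem_univ v
    exact ⟨fun a b => Finset.disjoint_left.1 hd b a, (Finset.mem_union.1 h1).resolve_left⟩
  have hD' (u v : Fin (n + 1)) :
      (decide (u ∈ D) == decide (v ∈ D)) = (decide (u ∈ S₀) == decide (v ∈ S₀)) := by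
    rcases hD with rfl | rfl
    · rfl
    · by_cases h1 : u ∈ S₀ <;> by_cases h2 : v ∈ S₀ <;> simp [hm, h1, h2]
  rw [score, edgesOne, edgesZero, card_filter_edgeFinset_pathGraph,
    card_filter_edgeFinset_pathGraph, cnt_ofFn, cnt_ofFn]
  congr 3 <;> ext i <;> simp only [Finset.mem_filter, hD'] <;>
    by_cases h1 : i.castSucc ∈ S₀ <;> by_cases h2 : i.succ ∈ S₀ <;> simp [hm, h1, h2]

/-! ### Forcing strategies bound the value. -/

section

variable {n : ℕ} (G : SimpleGraph (Fin n)) [DecidableRel G.Adj]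

theorem labels_insert_insert {A D : Finset (Fin n)} {v w : Fin n} (hv : v ∉ D) :
    ((labels A D).set v (some false)).set w (some true) = labels (insert v A) (insert w D) := by
  rw [labels_set_false hv, labels_set_true]

/-- Admirable is the second player here, hence the order `labels S₁ S₀`. Impish's best move is a
first player's move, and the strategy's reply bounds Admirable's minimum. -/
theorem value_impish_le_of_forces {P : List Bool → Prop} {c : ℤ}
    (hP : ∀ S₀ S₁ : Finset (Fin n), S₀ ∪ S₁ = Finset.univ → Disjoint S₀ S₁ →
      P (List.ofFn fun v => decide (v ∈ S₀)) → score G S₀ S₁ ≤ c)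
    {L : List (Option Bool)} (h : Forces P L) : ∀ S₀ S₁ : Finset (Fin n), Disjoint S₀ S₁ →
      labels S₁ S₀ = L → value G .impish S₀ S₁ ≤ c := by
  induction h with
  | intro L r h1 h2 h3 ih =>
    rintro S₀ S₁ hd rfl
    rcases (S₀ ∪ S₁)ᶜ.eq_empty_or_nonempty with he | hne
    · rw [value_eq_score G _ he]
      rw [Finset.compl_eq_empty_iff] at he
      exact hP S₀ S₁ he hd (h3 _ (labels_of_union_eq_univ (by rw [Finset.union_comm, he])))
    · obtain ⟨v, hv, e⟩ := exists_value_impish_eq G hne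
      rw [Finset.mem_union, not_or] at hv
      have hi := labels_getElem?_eq_none.2 ⟨v, rfl, hv.2, hv.1⟩
      have hr := h1 v hi
      rw [labels_set_false hv.1] at hr
      obtain ⟨w, hw, hw1, hw2⟩ := labels_getElem?_eq_none.1 hr
      have ih := ih v hi
      rw [← hw, labels_insert_insert hv.1] at ih
      rw [e]
      refine (value_admirable_le G (Finset.notMem_union.2 ⟨hw2, hw1⟩)).trans (ih _ _ ?_ rfl)
      rw [Finset.disjoint_insert_left, Finset.disjoint_insert_right]
      exact ⟨hw1, hv.1, hd⟩

theorem le_value_admirable_of_forces {P : List Bool → Prop} {c : ℤ}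
    (hP : ∀ S₀ S₁ : Finset (Fin n), S₀ ∪ S₁ = Finset.univ → Disjoint S₀ S₁ →
      P (List.ofFn fun v => decide (v ∈ S₁)) → c ≤ score G S₀ S₁)
    {L : List (Option Bool)} (h : Forces P L) : ∀ S₀ S₁ : Finset (Fin n), Disjoint S₀ S₁ →
      labels S₀ S₁ = L → c ≤ value G .admirable S₀ S₁ := by
  induction h with
  | intro L r h1 h2 h3 ih =>
    rintro S₀ S₁ hd rfl
    rcases (S₀ ∪ S₁)ᶜ.eq_empty_or_nonempty with he | hne
    · rw [value_eq_score G _ he]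
      rw [Finset.compl_eq_empty_iff] at he
      exact hP S₀ S₁ he hd (h3 _ (labels_of_union_eq_univ he))
    · obtain ⟨v, hv, e⟩ := exists_value_admirable_eq G hne
      rw [Finset.mem_union, not_or] at hv
      have hi := labels_getElem?_eq_none.2 ⟨v, rfl, hv.1, hv.2⟩
      have hr := h1 v hi
      rw [labels_set_false hv.2] at hr
      obtain ⟨w, hw, hw1, hw2⟩ := labels_getElem?_eq_none.1 hr
      have ih := ih v hi
      rw [← hw, labels_insert_insert hv.2] at ih
      rw [e]
      refine le_trans (ih _ _ ?_ rfl) (le_value_impish G (Finset.notMem_union.2 ⟨hw1, hw2⟩))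
      rw [Finset.disjoint_insert_left, Finset.disjoint_insert_right]
      rw [Finset.mem_insert, not_or] at hw1
      exact ⟨by simp [Ne.symm hw1.1, hv.2], hw1.2, hd⟩

/-- One more vertex, when Impish is to move and the number of unlabelled vertices is odd. -/
theorem value_impish_le_of_forces_concat {P Q : List Bool → Prop} {c : ℤ}
    (hQ : ∀ S₀ S₁ : Finset (Fin n), S₀ ∪ S₁ = Finset.univ → Disjoint S₀ S₁ →
      Q (List.ofFn fun v => decide (v ∈ S₀)) → score G S₀ S₁ ≤ c)
    (hPQ : ∀ b M, P M → Q (M ++ [b])) (hn : Odd n) {K : List (Option Bool)} (h : Forces P K) :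
    ∀ S₀ S₁ : Finset (Fin n), Disjoint S₀ S₁ → S₀.card = S₁.card →
      labels S₁ S₀ = K ++ [none] → value G .impish S₀ S₁ ≤ c := by
  induction h with
  | intro K r h1 h2 h3 ih =>
    intro S₀ S₁ hd hcard hL
    have hlast : (labels S₁ S₀)[K.length]? = some none := by simp [hL]
    obtain ⟨u, hu, hu1, hu0⟩ := labels_getElem?_eq_none.1 hlast
    obtain ⟨v, hv, e⟩ := exists_value_impish_eq G (S₀ := S₀) (S₁ := S₁)
      ⟨u, by simp [hu0, hu1]⟩
    rw [e]
    have hv' := hv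
    rw [Finset.mem_union, not_or] at hv'
    obtain ⟨hv0, hv1⟩ := hv'
    have hi : (labels S₁ S₀)[v.1]? = some none := labels_getElem?_eq_none.2 ⟨v, rfl, hv1, hv0⟩
    have hlen : n = K.length + 1 := by simpa [labels] using congrArg List.length hL
    rcases lt_or_ge v.1 K.length with hlt | hge
    · rw [hL, List.getElem?_append_left hlt] at hi
      have hr := h1 v hi
      have hrl : r v < (K.set v (some false)).length := (List.getElem?_eq_some_iff.1 hr).1
      have hset : labels (insert v S₁) S₀ = K.set v (some false) ++ [none] := by
        rw [← labels_set_false hv0, hL, List.set_append_left _ _ hlt]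
      rw [← List.getElem?_append_left (l₂ := [none]) hrl, ← hset] at hr
      obtain ⟨w, hw, hw1, hw0⟩ := labels_getElem?_eq_none.1 hr
      refine (value_admirable_le G (Finset.notMem_union.2 ⟨hw0, hw1⟩)).trans
        (ih v hi _ _ ?_ ?_ ?_)
      · rw [Finset.disjoint_insert_left, Finset.disjoint_insert_right]
        exact ⟨hw1, hv0, hd⟩
      · rw [Finset.card_insert_of_notMem hw0, Finset.card_insert_of_notMem hv1, hcard]
      · rw [← labels_set_true, hset, hw, List.set_append_left _ _ hrl]
    -- Impish has taken the spare last vertex, which leaves Admirable to move with an even number of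
    -- unlabelled vertices. Giving the move back to Impish can only raise the value, and then the
    -- strategy on `K` continues.
    · have hvK : v.1 = K.length := by omega
      have hd' : Disjoint S₀ (insert v S₁) := Finset.disjoint_insert_right.2 ⟨hv0, hd⟩
      refine (value_admirable_le_value_impish G ?_).trans (value_impish_le_of_forces G hQ
        (L := K ++ [some false]) ?_ _ _ hd' ?_)
      · rw [Finset.card_compl, Finset.card_union_of_disjoint hd',
          Finset.card_insert_of_notMem hv1, Fintype.card_fin, hcard]
        have : (S₀ ∪ insert v S₁).card ≤ n := by simpa using Finset.card_le_univ (S₀ ∪ insert v S₁)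
        rw [Finset.card_union_of_disjoint hd', Finset.card_insert_of_notMem hv1, hcard] at this
        obtain ⟨k, hk⟩ := hn
        exact ⟨k - S₁.card, by omega⟩
      · refine (Forces.intro K r h1 h2 h3).append (P := P) (Q := fun M => M = [false]) ?_ ?_
        · rintro M _ hM rfl
          exact hPQ _ _ hM
        · refine .of_exists (fun i hi => ?_) fun M hM => ?_
          · rw [List.getElem?_singleton] at hi
            split_ifs at hi
            simp at hi
          · exact List.map_injective_iff.2 (Option.some_injective _) hM.symm
      · rw [← labels_set_false hv0, hL, hvK]
        simp

end

theorem labels_empty (n : ℕ) : labels (∅ : Finset (Fin n)) ∅ = List.replicate n none := by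
  simp [labels, List.ofFn_const]

theorem score_pathGraph_le {n : ℕ} [DecidableRel (SimpleGraph.pathGraph (n + 1)).Adj]
    {S₀ S₁ : Finset (Fin (n + 1))} (h : S₀ ∪ S₁ = Finset.univ) (hd : Disjoint S₀ S₁) {t : ℕ}
    (ht : t ≤ cnt true (List.ofFn fun v => decide (v ∈ S₀))) :
    score (SimpleGraph.pathGraph (n + 1)) S₀ S₁ ≤ n - 2 * t := by
  have := cnt_add_cnt fun v : Fin (n + 1) => decide (v ∈ S₀)
  rw [score_pathGraph h hd (.inl rfl)]
  omega

theorem le_score_pathGraph {n : ℕ} [DecidableRel (SimpleGraph.pathGraph (n + 1)).Adj]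
    {S₀ S₁ : Finset (Fin (n + 1))} (h : S₀ ∪ S₁ = Finset.univ) (hd : Disjoint S₀ S₁) {t : ℕ}
    (ht : t ≤ cnt false (List.ofFn fun v => decide (v ∈ S₁))) :
    2 * t - n ≤ score (SimpleGraph.pathGraph (n + 1)) S₀ S₁ := by
  have := cnt_add_cnt fun v : Fin (n + 1) => decide (v ∈ S₁)
  rw [score_pathGraph h hd (.inr rfl)]
  omega

/-! ### Bounds for paths by parity. -/

section

variable {n : ℕ} [DecidableRel (SimpleGraph.pathGraph (n + 1)).Adj]

theorem balanceNumberI_le_of_even {q r : ℕ} (hn : n + 1 = 16 * q + r) (hr : r < 16)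
    (he : Even r) : balanceNumberI (SimpleGraph.pathGraph (n + 1)) ≤
      n - 2 * ((6 * q + (r - 4) / 2 : ℕ) : ℤ) :=
  value_impish_le_of_forces _ (fun _ _ h hd ht => score_pathGraph_le h hd ht)
    (forces_equal_replicate q hr he) ∅ ∅ (Finset.disjoint_empty_left _) (by rw [labels_empty, hn])

theorem balanceNumberI_le_of_odd {q r : ℕ} (hn : n = 16 * q + r) (hr : r < 16) (he : Even r) :
    balanceNumberI (SimpleGraph.pathGraph (n + 1)) ≤
      n - 2 * ((6 * q + (r - 4) / 2 : ℕ) : ℤ) := by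
  refine value_impish_le_of_forces_concat (Q := fun M => 6 * q + (r - 4) / 2 ≤ cnt true M) _
    (fun _ _ h hd ht => score_pathGraph_le h hd ht)
    (fun b M hM => hM.trans (le_trans (Nat.le_add_right _ _) (cnt_append true M [b]))) ?_
    (forces_equal_replicate q hr he) ∅ ∅ (Finset.disjoint_empty_left _) rfl ?_
  · obtain ⟨k, rfl⟩ := he
    exact ⟨8 * q + k, by omega⟩
  · rw [labels_empty, hn, List.replicate_succ']

/-- Impish would secure this as second player, and starting is at least as good when all the
vertices are even in number. -/
theorem le_balanceNumberI_of_even {q k : ℕ} (hn : n + 1 = 16 * q + 2 * k) :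
    2 * ((9 * q + k : ℕ) : ℤ) - n ≤ balanceNumberI (SimpleGraph.pathGraph (n + 1)) := by
  refine le_trans ?_ (value_admirable_le_value_impish _ ⟨8 * q + k, ?_⟩)
  · exact le_value_admirable_of_forces _ (fun _ _ h hd ht => le_score_pathGraph h hd ht)
      (forces_different_replicate q k) ∅ ∅ (Finset.disjoint_empty_left _)
      (by rw [labels_empty, hn])
  · simp
    omega

/-- Impish opens at the last vertex and is then second on the first `n` vertices; the last edge is
given away. -/
theorem le_balanceNumberI_of_odd {q k : ℕ} (hn : n = 16 * q + 2 * k) :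
    2 * ((9 * q + k : ℕ) : ℤ) - n ≤ balanceNumberI (SimpleGraph.pathGraph (n + 1)) := by
  refine le_trans ?_ (le_value_impish _ (v := Fin.last n) (by simp))
  refine le_value_admirable_of_forces (P := fun M => 9 * q + k ≤ cnt false M) _
    (fun _ _ h hd ht => le_score_pathGraph h hd ht)
    (L := List.replicate n none ++ [some true]) ?_ ∅ _ (Finset.disjoint_empty_left _) ?_
  · rw [hn]
    refine (forces_different_replicate q k).append (Q := fun _ => True)
      (fun M N hM _ => hM.trans (le_trans (Nat.le_add_right _ _) (cnt_append false M N))) ?_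
    refine .of_exists (fun i hi => ?_) fun _ _ => trivial
    rw [List.getElem?_singleton] at hi
    split_ifs at hi
    simp at hi
  · rw [← labels_set_true, labels_empty, List.replicate_succ', Fin.val_last,
      List.set_append_right _ _ (by simp)]
    simp

end

end BalanceGame

theorem mainTheorem8 (n : ℕ) (hn : 1 ≤ n) [DecidableRel (SimpleGraph.pathGraph n).Adj] :
    (Even n →
      2 * ⌊(n : ℚ) / 16⌋ - 5 ≤ BalanceGame.balanceNumberI (SimpleGraph.pathGraph n) ∧
      BalanceGame.balanceNumberI (SimpleGraph.pathGraph n) ≤ 4 * ⌈(n : ℚ) / 16⌉ - 1) ∧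
    (Odd n →
      2 * ⌊(n : ℚ) / 16⌋ ≤ BalanceGame.balanceNumberI (SimpleGraph.pathGraph n) ∧
      BalanceGame.balanceNumberI (SimpleGraph.pathGraph n) ≤ 4 * ⌈(n : ℚ) / 16⌉ + 4) := by
  have hfloor : 16 * ⌊(n : ℚ) / 16⌋ ≤ n := by
    have := Int.floor_le ((n : ℚ) / 16)
    rw [le_div_iff₀ (by norm_num)] at this
    have : ((16 * ⌊(n : ℚ) / 16⌋ : ℤ) : ℚ) ≤ ((n : ℤ) : ℚ) := by push_cast; linarith
    exact_mod_cast this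
  have hceil : (n : ℤ) ≤ 16 * ⌈(n : ℚ) / 16⌉ := by
    have := Int.le_ceil ((n : ℚ) / 16)
    rw [div_le_iff₀ (by norm_num)] at this
    have : ((n : ℤ) : ℚ) ≤ ((16 * ⌈(n : ℚ) / 16⌉ : ℤ) : ℚ) := by push_cast; linarith
    exact_mod_cast this
  -- One inequality for each rounding suffices: both bounds increase with the rounded quotient, so
  -- only `16 * f ≤ n` and `n ≤ 16 * z` are needed.
  generalize ⌊(n : ℚ) / 16⌋ = f at hfloor ⊢
  generalize ⌈(n : ℚ) / 16⌉ = z at hceil ⊢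
  obtain ⟨m, rfl⟩ : ∃ m, n = m + 1 := ⟨n - 1, by omega⟩
  refine ⟨fun he => ?_, fun ho => ?_⟩
  · have h2 : (m + 1) % 2 = 0 := Nat.even_iff.1 he
    have hl := BalanceGame.le_balanceNumberI_of_even (n := m) (q := (m + 1) / 16)
      (k := (m + 1) % 16 / 2) (by omega)
    have hu := BalanceGame.balanceNumberI_le_of_even (n := m) (q := (m + 1) / 16)
      (r := (m + 1) % 16) (by omega) (by omega) (Nat.even_iff.2 (by omega))
    generalize BalanceGame.balanceNumberI (SimpleGraph.pathGraph (m + 1)) = b at hl hu ⊢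
    omega
  · have h2 : (m + 1) % 2 = 1 := Nat.odd_iff.1 ho
    -- Since `m + 1` is odd, it is not a multiple of 16, so `16 * f ≤ m + 1` still gives `f ≤ m /
    -- 16`.
    have hl := BalanceGame.le_balanceNumberI_of_odd (n := m) (q := m / 16)
      (k := m % 16 / 2) (by omega)
    have hu := BalanceGame.balanceNumberI_le_of_odd (n := m) (q := m / 16)
      (r := m % 16) (by omega) (by omega) (Nat.even_iff.2 (by omega))
    generalize BalanceGame.balanceNumberI (SimpleGraph.pathGraph (m + 1)) = b at hl hu ⊢
    omega
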